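/- Let $n$ be a nonnegative integer and let $[n]=\{1,\dots,n\}$. A generalized tournament matrix of order $n$ is an entrywise nonnegative real $n\times n$ matrix $M=(m_{ij})$ with $M+M^{t}=J_n-I_n$, where $J_n$ is the all-ones matrix and $I_n$ the identity matrix. For a nonempty subset $X\subseteq[n]$, let $M[X]$ be the submatrix of $M$ whose rows and columns are indexed by $X$; its determinant is a principal minor of $M$ of order $|X|$. A subset $X\subseteq[n]$ is a clan of $M$ if $m_{ik}=m_{jk}$ and $m_{ki}=m_{kj}$ for all $i,j\in X$ and $k\in[n]\setminus X$. For $X\subseteq[n]$, let $\mathrm{Inv}(M,X)$ be the matrix obtained from $M$ by replacing the entry $m_{ij}$ by $m_{ji}$ for all $i,j\in X$. Theorem. Let $A$ and $B$ be two $n\times n$ generalized tournament matrices. The following assertions are equivalent: (i) $A$ and $B$ have the same corresponding principal minors of orders at most $4$, that is, $\det A[X]=\det B[X]$ for every nonempty $X\subseteq[n]$ with $|X|\le 4$. (ii) $A$ and $B$ have the same corresponding principal minors of every order, that is, $\det A[X]=\det B[X]$ for every nonempty $X\subseteq[n]$. (iii) There exist an integer $m\ge 0$ and a sequence $A_0=A,\dots,A_m=B$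 of $n\times n$ generalized tournament matrices such that, for each $k=0,\dots,m-1$, $A_{k+1}=\mathrm{Inv}(A_k,X_k)$ for some clan $X_k$ of $A_k$. -/

import Mathlib

/-- A generalized tournament matrix: an entrywise nonnegative real matrix `M` with
`M + Mᵗ = J - I`, where `J` is the all-ones matrix. -/
def IsGenTournament {n : ℕ} (M : Matrix (Fin n) (Fin n) ℝ) : Prop :=
  (∀ i j, 0 ≤ M i j) ∧ M + M.transpose = Matrix.of (fun _ _ => (1 : ℝ)) - 1

/-- The principal minor `det M[X]`, of order `X.card`. -/
noncomputable def principalMinor {n : ℕ} (M : Matrix (Fin n) (Fin n) ℝ)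
    (X : Finset (Fin n)) : ℝ :=
  (M.submatrix (fun i : X => (i : Fin n)) (fun i : X => (i : Fin n))).det

/-- `X` is a clan of `M`: the elements of `X` are not distinguished by any index outside `X`. -/
def IsClan {n : ℕ} (M : Matrix (Fin n) (Fin n) ℝ) (X : Finset (Fin n)) : Prop :=
  ∀ i ∈ X, ∀ j ∈ X, ∀ k, k ∉ X → M i k = M j k ∧ M k i = M k j

/-- `Inv(M, X)`: the entry `m_ij` is replaced by `m_ji` for all `i, j ∈ X`. -/
def invOn {n : ℕ} (M : Matrix (Fin n) (Fin n) ℝ) (X : Finset (Fin n)) :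
    Matrix (Fin n) (Fin n) ℝ :=
  Matrix.of fun i j => if i ∈ X ∧ j ∈ X then M j i else M i j

/-!
Write a generalized tournament matrix as `(J - I + s) / 2` with `s` skew-symmetric. Then `X` is a
clan iff `s i k = s j k` for all `i, j ∈ X`, `k ∉ X`, and inverting `X` changes the sign of `s` on
the block of `X`.

Inverting a clan preserves all minors: outside the block of `X` the rows and columns indexed by `X`
are constant, so the determinant depends on that block `P` only through `det P` and the sum of the
entries of `adjugate P`, which are invariant under transposition
(`Matrix.det_fromBlocks_transpose_of_const`).

Conversely, let `A`, `B` have the same minors of orders at most `4`, with skew arrays `s`, `t`.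
Given the smaller orders, order `2` says `t i j = ± s i j`, order `3` fixes
`s i j * s j k + s j k * s k i + s k i * s i j`, and order `4` fixes one quartic invariant
(`minorTwins_of_minors`). The cubic condition yields the triangle rule used throughout: if `i j` is
the only reversed pair of a triangle `i j k`, or the only pair not reversed, then `s i k = s j k`.
Consider the graph of the pairs with `t i j ≠ s i j` and the graph of those with `t i j ≠ -s i j`.

* By the triangle rule the components of either graph are common clans of `s` and `t`. So if one of
  the graphs is disconnected, then `t = ± s` or there is a nontrivial common clan
  (`MinorTwins.exists_common_clan_of_not_connectedOn`).
* If both are connected, there are four vertices on which they are complementary paths, and the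
  quartic condition makes `s` a linear order with constant weight `u ≠ 0` there. In particular `s`
  has a front: a nonempty proper subset `P` with `s p q = u` for `p ∈ P` and `q ∉ P`
  (`MinorTwins.exists_front_of_connectedOn`).
* Adding a vertex that has neighbours of both kinds preserves the existence of a front
  (`MinorTwins.exists_front_insert`). Thus a maximal set on which both graphs are connected and `s`
  has a front is the whole vertex set or a common clan.
* A minimal front of `s` is a clan of `t` (`MinorTwins.isClanIn_of_minimal_front`), so it is a
  common clan. If it is a single vertex `p`, one clan inversion of `t` makes `p` a front of `t` as well,
  and then the complement of `p` is a common clan.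

A nontrivial common clan permits induction: solve the problem on the quotient, lift the inversions
(`steps_lift_contraction`), then solve it inside the clan (`exists_steps_of_minors`).
-/

/-! ### Skew arrays with the same minors of orders at most four -/

/-- Two skew-symmetric real arrays `s`, `t` which on `V` have equal entries up to sign and the same
cubic and quartic invariants. For `s = A - Aᵀ` and `t = B - Bᵀ` this expresses that the generalized
tournament matrices `A` and `B` have the same principal minors of orders `2`, `3` and `4` in `V`. -/
structure MinorTwins {ι : Type*} (V : Finset ι) (s t : ι → ι → ℝ) : Prop where
  skew_left : ∀ i j, s j i = -s i j
  skew_right : ∀ i j, t j i = -t i j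
  two : ∀ i ∈ V, ∀ j ∈ V, t i j = s i j ∨ t i j = -s i j
  three : ∀ i ∈ V, ∀ j ∈ V, ∀ k ∈ V,
    t i j * t j k + t j k * t k i + t k i * t i j = s i j * s j k + s j k * s k i + s k i * s i j
  four : ∀ i ∈ V, ∀ j ∈ V, ∀ k ∈ V, ∀ l ∈ V, i ≠ j → i ≠ k → i ≠ l → j ≠ k → j ≠ l → k ≠ l →
    (t i j * t k l) * (t i k * t j l) + (t i k * t j l) * (t i l * t j k)
        - (t i j * t k l) * (t i l * t j k) =
      (s i j * s k l) * (s i k * s j l) + (s i k * s j l) * (s i l * s j k)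
        - (s i j * s k l) * (s i l * s j k)

/-- Connectedness of the graph with adjacency `P` on the vertex set `W`, expressed by cuts. -/
def ConnectedOn {ι : Type*} (P : ι → ι → Prop) (W : Finset ι) : Prop :=
  ∀ X ⊆ W, X.Nonempty → X ≠ W → ∃ x ∈ X, ∃ y ∈ W, y ∉ X ∧ P x y

/-- `P` is a nonempty proper subset of `W` all of whose elements `p` satisfy `s p q = u` for every
`q` in the rest of `W`. -/
def IsFront {ι : Type*} (s : ι → ι → ℝ) (u : ℝ) (W P : Finset ι) : Prop :=
  P ⊆ W ∧ P.Nonempty ∧ P ≠ W ∧ ∀ p ∈ P, ∀ q ∈ W, q ∉ P → s p q = u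

/-- `X` is a clan of the skew array `s` restricted to `V`. -/
def IsClanIn {ι : Type*} (s : ι → ι → ℝ) (V X : Finset ι) : Prop :=
  ∀ i ∈ X, ∀ j ∈ X, ∀ k ∈ V, k ∉ X → s i k = s j k

section Skew

variable {ι : Type*} {V W P : Finset ι} {s t : ι → ι → ℝ} {u : ℝ}

namespace MinorTwins

theorem mono (h : MinorTwins V s t) (hW : W ⊆ V) : MinorTwins W s t where
  skew_left := h.skew_left
  skew_right := h.skew_right
  two i hi j hj := h.two i (hW hi) j (hW hj)
  three i hi j hj k hk := h.three i (hW hi) j (hW hj) k (hW hk)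
  four i hi j hj k hk l hl := h.four i (hW hi) j (hW hj) k (hW hk) l (hW hl)

theorem neg_right (h : MinorTwins V s t) : MinorTwins V s (fun i j => -t i j) where
  skew_left := h.skew_left
  skew_right i j := by rw [h.skew_right i j]
  two i hi j hj := by
    rcases h.two i hi j hj with e | e <;> simp [e]
  three i hi j hj k hk := by rw [← h.three i hi j hj k hk]; ring
  four i hi j hj k hk l hl h1 h2 h3 h4 h5 h6 := by
    rw [← h.four i hi j hj k hk l hl h1 h2 h3 h4 h5 h6]; ring

theorem neg_left (h : MinorTwins V s t) : MinorTwins V (fun i j => -s i j) t where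
  skew_left i j := by rw [h.skew_left i j]
  skew_right := h.skew_right
  two i hi j hj := by
    rcases h.two i hi j hj with e | e <;> simp [e]
  three i hi j hj k hk := by rw [h.three i hi j hj k hk]; ring
  four i hi j hj k hk l hl h1 h2 h3 h4 h5 h6 := by
    rw [h.four i hi j hj k hk l hl h1 h2 h3 h4 h5 h6]; ring

theorem self_left (h : MinorTwins V s t) (i : ι) : s i i = 0 := by
  linarith [h.skew_left i i]

/-- If exactly one side `ij` of a triangle is reversed, then `k` does not separate `i` from `j`. -/
theorem eq_of_isolated (h : MinorTwins V s t) {i j k : ι} (hi : i ∈ V) (hj : j ∈ V) (hk : k ∈ V)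
    (hij : t i j ≠ s i j) (hik : t i k = s i k) (hjk : t j k = s j k) : s i k = s j k := by
  have h3 := h.three i hi j hj k hk
  have e := (h.two i hi j hj).resolve_left hij
  have hs : s i j ≠ 0 := fun h0 => hij (by rw [e, h0, neg_zero])
  rw [h.skew_right i k, h.skew_left i k, hik, hjk, e] at h3
  have : s i j * (s i k - s j k) = 0 := by linarith
  linarith [(mul_eq_zero.mp this).resolve_left hs]

/-- If exactly one side `ij` of a triangle is not reversed, then `k` does not separate `i` from
`j`. -/
theorem eq_of_isolated_neg (h : MinorTwins V s t) {i j k : ι} (hi : i ∈ V) (hj : j ∈ V)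
    (hk : k ∈ V) (hij : t i j ≠ -s i j) (hik : t i k = -s i k) (hjk : t j k = -s j k) :
    s i k = s j k :=
  h.neg_right.eq_of_isolated hi hj hk (fun e => hij (by linarith)) (by linarith) (by linarith)

theorem eq_symm (h : MinorTwins V s t) {i j : ι} (e : t i j = s i j) : t j i = s j i := by
  rw [h.skew_left i j, h.skew_right i j, e]

theorem eq_neg_symm (h : MinorTwins V s t) {i j : ι} (e : t i j = -s i j) : t j i = -s j i := by
  rw [h.skew_left i j, h.skew_right i j, e]

end MinorTwins

/-! ### Connectedness by cuts -/

theorem ConnectedOn.insert [DecidableEq ι] {R : ι → ι → Prop} (hR : ∀ x y, R x y → R y x)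
    (h : ConnectedOn R W) {v w : ι} (hw : w ∈ W) (hvw : R v w) : ConnectedOn R (insert v W) := by
  intro X hX hne hXW
  by_cases hv : v ∈ W
  · rw [Finset.insert_eq_of_mem hv] at hX hXW ⊢
    exact h X hX hne hXW
  by_cases h1 : (X ∩ W).Nonempty
  · by_cases h2 : X ∩ W = W
    · have hWX : W ⊆ X := Finset.inter_eq_right.mp h2
      have hvX : v ∉ X := fun hvX => hXW (hX.antisymm (Finset.insert_subset hvX hWX))
      exact ⟨w, hWX hw, v, by simp, hvX, hR _ _ hvw⟩
    · obtain ⟨x, hx, y, hy, hyX, hxy⟩ := h _ Finset.inter_subset_right h1 h2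
      simp only [Finset.mem_inter] at hx hyX
      exact ⟨x, hx.1, y, by simp [hy], fun hh => hyX ⟨hh, hy⟩, hxy⟩
  · obtain ⟨x, hx⟩ := hne
    have hxv : x = v := by
      rcases Finset.mem_insert.mp (hX hx) with e | e
      · exact e
      · exact absurd ⟨x, by simp [hx, e]⟩ h1
    subst hxv
    exact ⟨x, hx, w, by simp [hw], fun hh => h1 ⟨w, by simp [hh, hw]⟩, hvw⟩

theorem connectedOn_singleton (R : ι → ι → Prop) (a : ι) : ConnectedOn R {a} := by
  intro X hX hne hXW
  exact absurd ((Finset.subset_singleton_iff.mp hX).resolve_left hne.ne_empty) hXW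

theorem ConnectedOn.const {R : ι → ι → Prop} (h : ConnectedOn R W) {f : ι → ℝ}
    (hf : ∀ x ∈ W, ∀ y ∈ W, R x y → f x = f y) {a b : ι} (ha : a ∈ W) (hb : b ∈ W) :
    f a = f b := by
  by_contra hne
  classical
  obtain ⟨x, hx, y, hy, hyX, hxy⟩ := h (W.filter fun x => f x = f a) (Finset.filter_subset _ _)
    ⟨a, by simp [ha]⟩ (fun e => hne (by
      have hb' := e ▸ hb
      exact (Finset.mem_filter.mp hb').2.symm))
  simp only [Finset.mem_filter] at hx hyX
  exact hyX ⟨hy, by rw [← hf x hx.1 y hy hxy, hx.2]⟩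

/-- The component of `x` in the graph of reversed pairs is a common clan of `s` and `t`. -/
theorem MinorTwins.exists_common_clan_of_not_connectedOn (h : MinorTwins V s t)
    (hc : ¬ConnectedOn (fun i j => t i j ≠ s i j) V) :
    (∀ i ∈ V, ∀ j ∈ V, t i j = s i j) ∨
      ∃ X ⊆ V, 2 ≤ X.card ∧ X ≠ V ∧ IsClanIn s V X ∧ IsClanIn t V X := by
  classical
  by_cases hst : ∀ i ∈ V, ∀ j ∈ V, t i j = s i j
  · exact Or.inl hst
  right
  push Not at hst
  obtain ⟨x, hx, y, hy, hxy⟩ := hst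
  let R : ι → ι → Prop := fun a b => b ∈ V ∧ t a b ≠ s a b
  let X := V.filter (fun z => Relation.ReflTransGen R x z)
  have hcross : ∀ a ∈ X, ∀ b ∈ V, b ∉ X → t a b = s a b := by
    intro a ha b hb hbX
    by_contra hab
    exact hbX (Finset.mem_filter.mpr ⟨hb, (Finset.mem_filter.mp ha).2.tail ⟨hb, hab⟩⟩)
  have hxX : x ∈ X := Finset.mem_filter.mpr ⟨hx, .refl⟩
  have hyX : y ∈ X := Finset.mem_filter.mpr ⟨hy, .single ⟨hy, hxy⟩⟩
  have hclan : ∀ i ∈ X, ∀ k ∈ V, k ∉ X → s i k = s x k := by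
    intro i hi k hk hkX
    have hxi := (Finset.mem_filter.mp hi).2
    clear hi
    induction hxi with
    | refl => rfl
    | @tail a b hab hR ih =>
      rw [← ih]
      have haV : a ∈ V := by
        rcases hab.cases_tail with e | ⟨c, _, hc⟩
        · rw [e]; exact hx
        · exact hc.1
      have ha : a ∈ X := Finset.mem_filter.mpr ⟨haV, hab⟩
      have hb : b ∈ X := Finset.mem_filter.mpr ⟨hR.1, hab.tail hR⟩
      exact (h.eq_of_isolated haV hR.1 hk hR.2 (hcross a ha k hk hkX) (hcross b hb k hk hkX)).symm
  have hclan' : IsClanIn s V X := fun i hi j hj k hk hkX => by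
    rw [hclan i hi k hk hkX, hclan j hj k hk hkX]
  refine ⟨X, Finset.filter_subset _ _, ?_, ?_, hclan', ?_⟩
  · refine Finset.one_lt_card.mpr ⟨x, hxX, y, hyX, ?_⟩
    rintro rfl
    exact hxy (by linarith [h.skew_left x x, h.skew_right x x])
  · intro hXV
    refine hc fun Y hYV hne hYne => ?_
    by_contra hno
    push Not at hno
    -- every vertex is joined to `x` by a path, which stays on one side of the cut `Y`
    have hside : ∀ z ∈ V, (x ∈ Y ↔ z ∈ Y) := by
      intro z hz
      have hxz := (Finset.mem_filter.mp (hXV ▸ hz : z ∈ X)).2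
      clear hz
      induction hxz with
      | refl => rfl
      | @tail a b hab hR ih =>
        have haV : a ∈ V := by
          rcases hab.cases_tail with e | ⟨c, _, hc⟩
          · rw [e]; exact hx
          · exact hc.1
        refine ih.trans ⟨?_, ?_⟩
        · intro ha
          by_contra hb
          exact hR.2 (hno a ha b hR.1 hb)
        · intro hb
          by_contra ha
          exact hR.2 (h.eq_symm (hno b hb a haV ha))
    obtain ⟨z, hz⟩ := hne
    exact hYne (hYV.antisymm fun w hw => (hside w hw).mp ((hside z (hYV hz)).mpr hz))
  · intro i hi j hj k hk hkX
    rw [hcross i hi k hk hkX, hcross j hj k hk hkX, hclan' i hi j hj k hk hkX]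

/-! ### Four vertices on which both graphs are paths -/

/-- When both graphs are connected, they are complementary paths on some four vertices. The
quartic invariant then forces all entries there to have the same absolute value, and these entries
form a linear order, whose first vertex is a front. -/
theorem MinorTwins.exists_front_of_connectedOn [DecidableEq ι] (h : MinorTwins V s t)
    (hcard : 2 ≤ V.card) (hR : ConnectedOn (fun i j => t i j ≠ s i j) V)
    (hE : ConnectedOn (fun i j => t i j ≠ -s i j) V) :
    ∃ W ⊆ V, ConnectedOn (fun i j => t i j ≠ s i j) W ∧ ConnectedOn (fun i j => t i j ≠ -s i j) W ∧
      ∃ u, u ≠ 0 ∧ ∃ P, IsFront s u W P := by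
  induction hn : V.card using Nat.strong_induction_on generalizing V with
  | _ n ih =>
  subst hn
  obtain ⟨v, hv⟩ : V.Nonempty := Finset.card_pos.mp (by omega)
  have hV' : (V.erase v).card = V.card - 1 := Finset.card_erase_of_mem hv
  have hsub : V.erase v ⊆ V := Finset.erase_subset _ _
  -- the vertex `v` has a neighbour of either kind
  have hvne : ({v} : Finset ι) ≠ V := fun e => by rw [← e] at hcard; simp at hcard
  obtain ⟨c, hcV, hcv, hvc⟩ : ∃ c ∈ V, c ≠ v ∧ t v c ≠ s v c := by
    obtain ⟨x, hx, y, hy, hyx, hxy⟩ := hR {v} (by simpa using hv) (by simp) hvne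
    simp only [Finset.mem_singleton] at hx hyx
    subst hx
    exact ⟨y, hy, hyx, hxy⟩
  by_cases hcon : ConnectedOn (fun i j => t i j ≠ s i j) (V.erase v) ∧
      ConnectedOn (fun i j => t i j ≠ -s i j) (V.erase v)
  · by_cases h2 : 2 ≤ (V.erase v).card
    · obtain ⟨W, hW, h'⟩ := ih _ (by omega) (h.mono hsub) h2 hcon.1 hcon.2 rfl
      exact ⟨W, hW.trans hsub, h'⟩
    · exfalso
      obtain ⟨x, hx, y, hy, hyx, hxy⟩ := hE {v} (by simpa using hv) (by simp) hvne
      simp only [Finset.mem_singleton] at hx hyx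
      subst hx
      have := Finset.card_le_one.mp (show (V.erase x).card ≤ 1 by omega) c (by simp [hcv, hcV]) y
        (by simp [hyx, hy])
      subst this
      exact (h.two x hv c hcV).elim hvc hxy
  clear ih
  -- one vertex `v` whose removal disconnects the graph of pairs that are not reversed
  have key : ∀ t : ι → ι → ℝ, MinorTwins V s t → ConnectedOn (fun i j => t i j ≠ s i j) V →
      ConnectedOn (fun i j => t i j ≠ -s i j) V →
      ¬ConnectedOn (fun i j => t i j ≠ -s i j) (V.erase v) →
      ∃ W ⊆ V, ConnectedOn (fun i j => t i j ≠ s i j) W ∧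
        ConnectedOn (fun i j => t i j ≠ -s i j) W ∧ ∃ u, u ≠ 0 ∧ ∃ P, IsFront s u W P := by
    clear hcon hR hE h hvc hcv hcV c t
    intro t h hR hE hcon
    obtain ⟨c, hcV, hcv, hvc⟩ : ∃ c ∈ V, c ≠ v ∧ t v c ≠ s v c := by
      obtain ⟨x, hx, y, hy, hyx, hxy⟩ := hR {v} (by simpa using hv) (by simp) hvne
      simp only [Finset.mem_singleton] at hx hyx
      subst hx
      exact ⟨y, hy, hyx, hxy⟩
    unfold ConnectedOn at hcon
    push Not at hcon
    obtain ⟨X₀, hX₀, hX₀ne, hX₀V, hX₀c⟩ := hcon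
    obtain ⟨X, Y, hXV, hYV, hXY, hXc, hcX, hvX, hvY, hYne⟩ : ∃ X Y : Finset ι, X ⊆ V ∧ Y ⊆ V ∧
        (∀ z ∈ V, z ≠ v → z ∉ X → z ∈ Y) ∧ (∀ x ∈ X, ∀ y ∈ Y, x ≠ y ∧ t x y = -s x y) ∧ c ∈ X ∧
        v ∉ X ∧ v ∉ Y ∧ Y.Nonempty := by
      have hne : (V.erase v \ X₀).Nonempty := by
        rw [Finset.sdiff_nonempty]
        exact fun hh => hX₀V (hX₀.antisymm hh)
      by_cases hc : c ∈ X₀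
      · refine ⟨X₀, V.erase v \ X₀, hX₀.trans hsub, Finset.sdiff_subset.trans hsub, ?_, ?_, hc,
          fun hh => by simpa using hX₀ hh, by simp, hne⟩
        · intro z hz hzv hzX
          simp [hz, hzv, hzX]
        · intro x hx y hy
          have := (Finset.mem_sdiff.mp hy)
          exact ⟨fun e => this.2 (e ▸ hx), hX₀c x hx y this.1 this.2⟩
      · refine ⟨V.erase v \ X₀, X₀, Finset.sdiff_subset.trans hsub, hX₀.trans hsub, ?_, ?_,
          by simp [hc, hcv, hcV], by simp, fun hh => by simpa using hX₀ hh, hX₀ne⟩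
        · intro z hz hzv hzX
          by_contra hh
          exact hzX (by simp [hz, hzv, hh])
        · intro y hy x hx
          have := (Finset.mem_sdiff.mp hy)
          exact ⟨fun e => this.2 (e ▸ hx), h.eq_neg_symm (hX₀c x hx y this.1 this.2)⟩
    -- a neighbour `d` of `v` in `Y`
    obtain ⟨d, hdY, hvd⟩ : ∃ d ∈ Y, t v d ≠ -s v d := by
      obtain ⟨x, hx, y, hy, hyx, hxy⟩ := hE Y hYV hYne (fun e => hvY (e ▸ hv))
      by_cases hyv : y = v
      · subst hyv
        exact ⟨x, hx, fun e => hxy (h.eq_neg_symm e)⟩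
      · have hyX : y ∈ X := by
          by_contra hh
          exact hyx (hXY y hy hyv hh)
        exact absurd (h.eq_neg_symm (hXc y hyX x hx).2) hxy
    have hdV := hYV hdY
    have hvd' : t v d = s v d := (h.two v hv d hdV).resolve_right hvd
    -- an edge `a b` leaving the set of reversed neighbours of `v` in `X`
    obtain ⟨a, haX, hva, b, hbX, hvb, hab⟩ : ∃ a ∈ X, t v a ≠ s v a ∧ ∃ b ∈ X, t v b = s v b ∧
        t a b ≠ -s a b := by
      obtain ⟨x, hx, y, hy, hyx, hxy⟩ := hE (X.filter fun x => t v x ≠ s v x)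
        ((Finset.filter_subset _ _).trans hXV) ⟨c, by simp [hcX, hvc]⟩
        (fun e => hvX (by rw [← e] at hv; exact (Finset.mem_filter.mp hv).1))
      simp only [Finset.mem_filter, not_and, not_not] at hx hyx
      have hyv : y ≠ v := by
        rintro rfl
        rcases h.two x (hXV hx.1) y hv with e | e
        · exact hx.2 (h.eq_symm e)
        · exact hxy e
      have hyX : y ∈ X := by
        by_contra hh
        exact hxy (hXc x hx.1 y (hXY y hy hyv hh)).2
      exact ⟨x, hx.1, hx.2, y, hyX, hyx hyX, hxy⟩
    have haV := hXV haX
    have hbV := hXV hbX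
    have hva' : t v a = -s v a := (h.two v hv a haV).resolve_left hva
    have hab' : t a b = s a b := (h.two a haV b hbV).resolve_right hab
    have had' := (hXc a haX d hdY).2
    have hbd' := (hXc b hbX d hdY).2
    have e1 : s v b = s a b := h.eq_of_isolated hv haV hbV hva hvb hab'
    have e2 : s a d = s b d := h.eq_of_isolated_neg haV hbV hdV hab had' hbd'
    have e3 : s v a = s d a := h.eq_of_isolated_neg hv hdV haV hvd hva' (h.eq_neg_symm had')
    have sab0 : s a b ≠ 0 := fun h0 => hab (by rw [hab', h0, neg_zero])
    have sva0 : s v a ≠ 0 := fun h0 => hva (by rw [hva', h0, neg_zero])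
    have svd0 : s v d ≠ 0 := fun h0 => hvd (by rw [hvd', h0, neg_zero])
    have s1 := h.skew_left v a
    have s2 := h.skew_left v b
    have s3 := h.skew_left v d
    have s4 := h.skew_left a b
    have s5 := h.skew_left a d
    have s6 := h.skew_left b d
    have sad0 : s a d ≠ 0 := fun h0 => sva0 (by rw [e3, s5, h0, neg_zero])
    have hbd : t b d ≠ s b d := fun e => sad0 (by linarith)
    have had : t a d ≠ s a d := fun e => sad0 (by linarith)
    have e4 : s d v = s b v :=
      (h.eq_of_isolated hbV hdV hv hbd (h.eq_symm hvb) (h.eq_symm hvd')).symm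
    have hvb2 : t v b ≠ -s v b := fun e => sab0 (by linarith)
    have nab : a ≠ b := by rintro rfl; exact sab0 (h.self_left _)
    have nad : a ≠ d := by rintro rfl; exact sad0 (h.self_left _)
    have nbd : b ≠ d := (hXc b hbX d hdY).1
    have nav : a ≠ v := by rintro rfl; exact hvX haX
    have nbv : b ≠ v := by rintro rfl; exact hvX hbX
    have ndv : d ≠ v := by rintro rfl; exact hvY hdY
    have h4 := h.four a haV b hbV d hdV v hv nab nad nav nbd nbv ndv
    have t1 := h.skew_right v a
    have t2 := h.skew_right v b
    have t3 := h.skew_right v d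
    have hsq : s a d = s a b ∨ s a d = -s a b := by
      have z1 : s b d = s a d := e2.symm
      have z2 : s v a = -s a d := by rw [e3, s5]
      have z3 : s v b = s a b := e1
      have z4 : s v d = s a b := by linarith
      rw [t1, t2, t3, hva', hvb, hvd', hab', had', hbd', s1, s2, s3, z1, z2, z3, z4] at h4
      have : (s a d * s a b) * (s a d ^ 2 - s a b ^ 2) = 0 := by linarith
      exact sq_eq_sq_iff_eq_or_eq_neg.mp (by
        linarith [(mul_eq_zero.mp this).resolve_left (mul_ne_zero sad0 sab0)])
    have hRs : ∀ x y, t x y ≠ s x y → t y x ≠ s y x := fun x y hh e => hh (h.eq_symm e)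
    have hEs : ∀ x y, t x y ≠ -s x y → t y x ≠ -s y x := fun x y hh e => hh (h.eq_neg_symm e)
    refine ⟨{a, b, d, v}, ?_, ?_, ?_, ?_⟩
    · intro z hz
      simp only [Finset.mem_insert, Finset.mem_singleton] at hz
      rcases hz with rfl | rfl | rfl | rfl <;> assumption
    · have : ({a, b, d, v} : Finset ι) = insert b (insert d (insert a {v})) := by
        ext z; simp only [Finset.mem_insert, Finset.mem_singleton]; tauto
      rw [this]
      refine ((((connectedOn_singleton _ v).insert hRs (w := v) (by simp) (hRs _ _ hva)).insert hRs
        (w := a) (by simp) (hRs _ _ had)).insert hRs (w := d) (by simp) hbd)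
    · have : ({a, b, d, v} : Finset ι) = insert a (insert b (insert d {v})) := by
        ext z; simp only [Finset.mem_insert, Finset.mem_singleton]
      rw [this]
      refine ((((connectedOn_singleton _ v).insert hEs (w := v) (by simp) (hEs _ _ hvd)).insert hEs
        (w := v) (by simp) (hEs _ _ hvb2)).insert hEs (w := b) (by simp) hab)
    · refine ⟨s a d, sad0, ?_⟩
      rcases hsq with hs | hs
      · refine ⟨{a}, by simp, by simp, fun e => nab ?_, ?_⟩
        · have : b ∈ ({a} : Finset ι) := by rw [e]; simp
          exact (Finset.mem_singleton.mp this).symm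
        · intro p hp q hq hqa
          simp only [Finset.mem_insert, Finset.mem_singleton] at hp hq hqa
          subst hp
          rcases hq with rfl | rfl | rfl | rfl
          · exact absurd rfl hqa
          · linarith
          · rfl
          · linarith
      · refine ⟨{b}, by simp, by simp, fun e => nab ?_, ?_⟩
        · have : a ∈ ({b} : Finset ι) := by rw [e]; simp
          exact (Finset.mem_singleton.mp this)
        · intro p hp q hq hqa
          simp only [Finset.mem_insert, Finset.mem_singleton] at hp hq hqa
          subst hp
          rcases hq with rfl | rfl | rfl | rfl
          · linarith
          · exact absurd rfl hqa
          · linarith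
          · linarith
  by_cases hE' : ConnectedOn (fun i j => t i j ≠ -s i j) (V.erase v)
  · have hR' : ¬ConnectedOn (fun i j => t i j ≠ s i j) (V.erase v) := fun hh => hcon ⟨hh, hE'⟩
    obtain ⟨W, hW, hR2, hE2, hf⟩ := key (fun i j => -t i j) h.neg_right
      (by simpa only [neg_eq_iff_eq_neg, ne_eq] using hE) (by simpa only [neg_inj, ne_eq] using hR)
      (by simpa only [neg_inj, ne_eq] using hR')
    exact ⟨W, hW, by simpa only [neg_inj, ne_eq] using hE2,
      by simpa only [neg_eq_iff_eq_neg, ne_eq] using hR2, hf⟩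
  · exact key t h hR hE hE'

end Skew

/-! ### Minimal fronts -/

section Fronts

variable {ι : Type*} {V W P : Finset ι} {s t : ι → ι → ℝ} {u : ℝ}

theorem IsFront.neg_swap [DecidableEq ι] (hs : ∀ i j, s j i = -s i j) (hP : IsFront s u W P) :
    IsFront (fun i j => -s i j) u W (W \ P) := by
  obtain ⟨h1, h2, h3, h4⟩ := hP
  refine ⟨Finset.sdiff_subset, ?_, ?_, ?_⟩
  · rw [Finset.sdiff_nonempty]
    exact fun hh => h3 (h1.antisymm hh)
  · intro e
    obtain ⟨p, hp⟩ := h2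
    have := e ▸ h1 hp
    exact (Finset.mem_sdiff.mp this).2 hp
  · intro q hq p hp hpq
    have hpP : p ∈ P := by
      by_contra hh
      exact hpq (Finset.mem_sdiff.mpr ⟨hp, hh⟩)
    have hq' := Finset.mem_sdiff.mp hq
    exact (hs q p).symm.trans (h4 p hpP q hq'.1 hq'.2)

theorem IsFront.exists_minimal (hP : IsFront s u W P) :
    ∃ P', IsFront s u W P' ∧ ∀ Q, IsFront s u W Q → Q ⊆ P' → Q = P' := by
  induction hn : P.card using Nat.strong_induction_on generalizing P with
  | _ n ih =>
  subst hn
  by_cases hmin : ∀ Q, IsFront s u W Q → Q ⊆ P → Q = P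
  · exact ⟨P, hP, hmin⟩
  · push Not at hmin
    obtain ⟨Q, hQ, hQP, hne⟩ := hmin
    exact ih _ (Finset.card_lt_card (hQP.ssubset_of_ne hne)) hQ rfl

/-- Fronts for the same nonzero value form a chain, so a minimal one is contained in all. -/
theorem IsFront.minimal_subset (hs : ∀ i j, s j i = -s i j) (hu : u ≠ 0) (hP : IsFront s u W P)
    (hmin : ∀ Q, IsFront s u W Q → Q ⊆ P → Q = P) {Q : Finset ι} (hQ : IsFront s u W Q) :
    P ⊆ Q := by
  by_cases hQP : Q ⊆ P
  · rw [hmin Q hQ hQP]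
  · rw [Finset.not_subset] at hQP
    obtain ⟨q, hq, hqP⟩ := hQP
    intro p hp
    by_contra hpQ
    have e1 := hP.2.2.2 p hp q (hQ.1 hq) hqP
    have e2 := hQ.2.2.2 q hq p (hP.1 hp) hpQ
    have := hs p q
    exact hu (by linarith)

/-- A minimal front of `s` is a clan of `t`. If `k` separated it in `t`, then between the two sides
`t i k = u` and `t j k = -u` all pairs would carry `s i j = ± u`, in an acyclic way, and the sources
of this orientation would form a smaller front. -/
theorem MinorTwins.isClanIn_of_minimal_front (h : MinorTwins W s t) (hu : u ≠ 0)
    (hP : IsFront s u W P) (hmin : ∀ Q, IsFront s u W Q → Q ⊆ P → Q = P) : IsClanIn t W P := by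
  classical
  have hk2 : ∀ k ∈ W, k ∉ P → ∀ i ∈ P, t i k = u ∨ t i k = -u := by
    intro k hk hkP i hi
    rw [← hP.2.2.2 i hi k hk hkP]
    exact h.two i (hP.1 hi) k hk
  by_contra hclan
  unfold IsClanIn at hclan
  push Not at hclan
  obtain ⟨i₀, hi₀, j₀, hj₀, k, hk, hkP, hij₀⟩ := hclan
  have hsk : ∀ i ∈ P, s i k = u := fun i hi => hP.2.2.2 i hi k hk hkP
  -- pairs on different sides of `k`
  have hcross : ∀ i ∈ P, ∀ j ∈ P, t i k ≠ t j k → s i j = u ∨ s j i = u := by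
    intro i hi j hj hne
    have h3 := h.three i (hP.1 hi) j (hP.1 hj) k hk
    have a1 := hsk i hi
    have a2 := hsk j hj
    have h2 := h.two i (hP.1 hi) j (hP.1 hj)
    rw [h.skew_left i k, h.skew_right i k, a1, a2] at h3
    have b1 := h.skew_left i j
    rcases hk2 k hk hkP i hi with c1 | c1 <;> rcases hk2 k hk hkP j hj with c2 | c2
    · exact absurd (c1.trans c2.symm) hne
    · rw [c1, c2] at h3
      have : u * (t i j - u) = 0 := by linarith
      have := (mul_eq_zero.mp this).resolve_left hu
      rcases h2 with e | e
      · left; linarith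
      · right; linarith
    · rw [c1, c2] at h3
      have : u * (t i j + u) = 0 := by linarith
      have := (mul_eq_zero.mp this).resolve_left hu
      rcases h2 with e | e
      · right; linarith
      · left; linarith
    · exact absurd (c1.trans c2.symm) hne
  -- the orientation is transitive along alternating paths
  have htrans : ∀ i ∈ P, ∀ j ∈ P, ∀ l ∈ P, t i k ≠ t j k → t j k ≠ t l k → s i j = u → s j l = u →
      s i l = u := by
    intro i hi j hj l hl hij hjl e1 e2
    have h3 := h.three i (hP.1 hi) j (hP.1 hj) l (hP.1 hl)
    have hi3 := h.three i (hP.1 hi) j (hP.1 hj) k hk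
    have hl3 := h.three j (hP.1 hj) l (hP.1 hl) k hk
    have f1 := hsk i hi
    have f2 := hsk j hj
    have f3 := hsk l hl
    rw [h.skew_left i k, h.skew_right i k, f1, f2, e1] at hi3
    rw [h.skew_left j k, h.skew_right j k, f2, f3, e2] at hl3
    rw [h.skew_left i l, h.skew_right i l, e1, e2] at h3
    rcases hk2 k hk hkP i hi with c1 | c1 <;> rcases hk2 k hk hkP j hj with c2 | c2 <;>
      rcases hk2 k hk hkP l hl with c3 | c3
    · exact absurd (c1.trans c2.symm) hij
    · exact absurd (c1.trans c2.symm) hij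
    · rw [c1, c2] at hi3
      rw [c2, c3] at hl3
      have g1 : t i j = u := by
        have : u * (t i j - u) = 0 := by linarith
        linarith [(mul_eq_zero.mp this).resolve_left hu]
      have g2 : t j l = -u := by
        have : u * (t j l + u) = 0 := by linarith
        linarith [(mul_eq_zero.mp this).resolve_left hu]
      rw [g1, g2] at h3
      have : u * (s i l - u) = 0 := by linarith
      linarith [(mul_eq_zero.mp this).resolve_left hu]
    · exact absurd (c2.trans c3.symm) hjl
    · exact absurd (c2.trans c3.symm) hjl
    · rw [c1, c2] at hi3
      rw [c2, c3] at hl3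
      have g1 : t i j = -u := by
        have : u * (t i j + u) = 0 := by linarith
        linarith [(mul_eq_zero.mp this).resolve_left hu]
      have g2 : t j l = u := by
        have : u * (t j l - u) = 0 := by linarith
        linarith [(mul_eq_zero.mp this).resolve_left hu]
      rw [g1, g2] at h3
      have : u * (s i l - u) = 0 := by linarith
      linarith [(mul_eq_zero.mp this).resolve_left hu]
    · exact absurd (c1.trans c2.symm) hij
    · exact absurd (c1.trans c2.symm) hij
  have hasymm : ∀ i j, s i j = u → s j i = u → False := by
    intro i j e1 e2
    have := h.skew_left i j
    exact hu (by linarith)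
  -- a vertex dominating everything on the other side of `k`
  obtain ⟨a, ha, hdom⟩ : ∃ a ∈ P, ∀ j ∈ P, t a k ≠ t j k → s a j = u := by
    obtain ⟨i, hi, hmax⟩ := Finset.exists_max_image (P.filter fun i => t i k = t i₀ k)
      (fun i => (P.filter fun j => t j k ≠ t i₀ k ∧ s i j = u).card) ⟨i₀, by simp [hi₀]⟩
    have hi' := Finset.mem_filter.mp hi
    by_cases hd : ∀ j ∈ P, t i k ≠ t j k → s i j = u
    · exact ⟨i, hi'.1, hd⟩
    push Not at hd
    obtain ⟨j, hj, hne, hsij⟩ := hd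
    have hji : s j i = u := (hcross i hi'.1 j hj hne).resolve_left hsij
    refine ⟨j, hj, fun l hl hjl => ?_⟩
    by_contra hsjl
    have hlj : s l j = u := (hcross j hj l hl hjl).resolve_left hsjl
    have hl_i : t l k = t i k := by
      rcases hk2 k hk hkP i hi'.1 with c1 | c1 <;> rcases hk2 k hk hkP j hj with c2 | c2 <;>
        rcases hk2 k hk hkP l hl with c3 | c3 <;> rw [c1, c2] at hne <;> rw [c2, c3] at hjl <;>
        first | exact c3.trans c1.symm | exact absurd rfl hne | exact absurd rfl hjl
    have hlt := hmax l (Finset.mem_filter.mpr ⟨hl, hl_i.trans hi'.2⟩)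
    refine absurd hlt (not_le.mpr (Finset.card_lt_card ?_))
    refine (Finset.ssubset_iff_of_subset ?_).mpr ⟨j, ?_, ?_⟩
    · intro m hm
      simp only [Finset.mem_filter] at hm ⊢
      refine ⟨hm.1, hm.2.1, ?_⟩
      have hlm : t l k ≠ t m k := by rw [hl_i, hi'.2]; exact hm.2.1.symm
      rcases hcross l hl m hm.1 hlm with e | e
      · exact e
      · -- otherwise `i → m → l → j → i` is a cycle
        have g1 := htrans i hi'.1 m hm.1 l hl (by rw [← hl_i]; exact hlm) hlm.symm hm.2.2 e
        have g2 := htrans l hl j hj i hi'.1 hjl.symm hne.symm hlj hji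
        exact (hasymm _ _ g1 g2).elim
    · simp only [Finset.mem_filter]
      exact ⟨hj, by rw [← hi'.2]; exact hne.symm, hlj⟩
    · simp only [Finset.mem_filter]
      exact fun hh => hsij hh.2.2
  -- the set of these vertices on the side of `a` is a smaller front
  let L := P.filter fun i => t i k = t a k ∧ ∀ j ∈ P, t i k ≠ t j k → s i j = u
  obtain ⟨b, hb, hab⟩ : ∃ b ∈ P, t a k ≠ t b k := by
    by_contra hno
    push Not at hno
    exact hij₀ ((hno i₀ hi₀).symm.trans (hno j₀ hj₀))
  have hbL : b ∉ L := fun hh => hab (Finset.mem_filter.mp hh).2.1.symm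
  have hLP : L ⊆ P := Finset.filter_subset _ _
  have hL : IsFront s u W L := by
    refine ⟨hLP.trans hP.1, ⟨a, Finset.mem_filter.mpr ⟨ha, rfl, hdom⟩⟩, ?_, ?_⟩
    · intro e
      exact hbL (e ▸ hP.1 hb)
    · intro i hi r hr hrL
      obtain ⟨hiP, hia, hid⟩ := Finset.mem_filter.mp hi
      by_cases hrP : r ∈ P
      · by_cases hir : t i k = t r k
        · have : ∃ j ∈ P, t r k ≠ t j k ∧ s r j ≠ u := by
            by_contra hno
            push Not at hno
            exact hrL (Finset.mem_filter.mpr ⟨hrP, hir.symm.trans hia, hno⟩)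
          obtain ⟨j, hj, hrj, hsrj⟩ := this
          have hij : t i k ≠ t j k := by rw [hir]; exact hrj
          exact htrans i hiP j hj r hrP hij hrj.symm (hid j hj hij)
            ((hcross r hrP j hj hrj).resolve_left hsrj)
        · exact hid r hrP hir
      · exact hP.2.2.2 i hiP r hr hrP
  exact hbL (hmin L hL hLP ▸ hb)

/-! ### Extending a front by one vertex -/

/-- If both graphs are connected on `W`, the vertex `v` has neighbours of both kinds in `W`, and `s`
has a front on `W`, then `s` also has a front on `insert v W`. Let `P` be the first and `Q` the last
part of the finest linear decomposition of `W`. If neither `P` nor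
`(W \ Q) ∪ {v}` is a front of `insert v W`, there are `p ∈ P` with `s p v ≠ u` and `q ∈ Q` with
`s v q ≠ u`. Up to a sign of `t` the pair `p q` is not reversed, and then the triangle condition
forces all neighbours of `v` in `W` to be of one kind. -/
theorem MinorTwins.exists_front_insert [DecidableEq ι] {v : ι} (h : MinorTwins (insert v W) s t)
    (hu : u ≠ 0) (hvW : v ∉ W) (hR : ConnectedOn (fun i j => t i j ≠ s i j) W)
    (hE : ConnectedOn (fun i j => t i j ≠ -s i j) W) (hvR : ∃ w ∈ W, t v w ≠ s v w)
    (hvE : ∃ w ∈ W, t v w ≠ -s v w) (hF : ∃ P, IsFront s u W P) :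
    ∃ P, IsFront s u (insert v W) P := by
  by_contra hno
  obtain ⟨F, hF⟩ := hF
  obtain ⟨P, hP, hPmin⟩ := hF.exists_minimal
  have hWs : W ⊆ insert v W := Finset.subset_insert v W
  have hW := h.mono hWs
  obtain ⟨Q, hQ, hQmin⟩ := (hF.neg_swap h.skew_left).exists_minimal
  have hvV : v ∈ insert v W := by simp
  have hskew' : ∀ i j, (fun i j => -s i j) j i = -(fun i j => -s i j) i j := by
    intro i j
    simp only [h.skew_left i j]
  have hQP : Q ⊆ W \ P := hQ.minimal_subset hskew' hu hQmin (hP.neg_swap h.skew_left)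
  have hPW := hP.1
  have hQW := hQ.1
  have hPQ : ∀ x ∈ P, x ∉ Q := fun x hx hxQ => (Finset.mem_sdiff.mp (hQP hxQ)).2 hx
  have hsP : ∀ p ∈ P, ∀ w ∈ W, w ∉ P → s p w = u := hP.2.2.2
  have hsQ : ∀ q ∈ Q, ∀ w ∈ W, w ∉ Q → s w q = u := by
    intro q hq w hw hwQ
    have := hQ.2.2.2 q hq w hw hwQ
    linarith [h.skew_left q w]
  have hcP := hW.isClanIn_of_minimal_front hu hP hPmin
  have hcQ := hW.neg_left.isClanIn_of_minimal_front hu hQ hQmin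
  obtain ⟨p, hp, hpv⟩ : ∃ p ∈ P, s p v ≠ u := by
    by_contra hall
    push Not at hall
    refine hno ⟨P, hP.1.trans hWs, hP.2.1, fun e => hvW (hPW (e ▸ hvV)), ?_⟩
    intro x hx w hw hwP
    rcases Finset.mem_insert.mp hw with rfl | hw
    · exact hall x hx
    · exact hsP x hx w hw hwP
  obtain ⟨q, hq, hqv⟩ : ∃ q ∈ Q, s v q ≠ u := by
    by_contra hall
    push Not at hall
    refine hno ⟨insert v W \ Q, Finset.sdiff_subset, ⟨v, ?_⟩, ?_, ?_⟩
    · exact Finset.mem_sdiff.mpr ⟨hvV, fun hh => hvW (hQW hh)⟩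
    · intro e
      obtain ⟨q, hq⟩ := hQ.2.1
      exact (Finset.mem_sdiff.mp (e ▸ hWs (hQW hq))).2 hq
    · intro x hx w hw hwQ
      have hwQ' : w ∈ Q := by
        by_contra hh
        exact hwQ (Finset.mem_sdiff.mpr ⟨hw, hh⟩)
      obtain ⟨hx1, hx2⟩ := Finset.mem_sdiff.mp hx
      rcases Finset.mem_insert.mp hx1 with rfl | hx1
      · exact hall w hwQ'
      · exact hsQ w hwQ' x hx1 hx2
  have key : ∀ t : ι → ι → ℝ, MinorTwins (insert v W) s t →
      ConnectedOn (fun i j => t i j ≠ s i j) W → (∃ w ∈ W, t v w ≠ s v w) →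
      (∃ w ∈ W, t v w ≠ -s v w) → IsClanIn t W P → IsClanIn t W Q → t p q = s p q → False := by
    clear hvR hvE hR hE hcP hcQ hW h
    intro t h hR hvR hvE hcP hcQ hpq
    have hpW := hPW hp
    have hqW := hQW hq
    have two : ∀ i ∈ insert v W, ∀ j ∈ insert v W, t i j ≠ s i j → t i j = -s i j :=
      fun i hi j hj => (h.two i hi j hj).resolve_left
    have two' : ∀ i ∈ insert v W, ∀ j ∈ insert v W, t i j ≠ -s i j → t i j = s i j :=
      fun i hi j hj => (h.two i hi j hj).resolve_right
    have hne : ∀ i j, s i j = u → t i j = s i j → t i j ≠ -s i j := by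
      intro i j e1 e2 e3
      exact hu (by linarith)
    have hPQe : ∀ x ∈ P, ∀ y ∈ Q, t x y = s x y := by
      intro x hx y hy
      have hyP : y ∉ P := fun hh => hPQ y hh hy
      have e1 := hcP x hx p hp y (hQW hy) hyP
      have e2 := hcQ y hy q hq p hpW (hPQ p hp)
      have e3 := hsP x hx y (hQW hy) hyP
      have e4 := hsP p hp q hqW (fun hh => hPQ q hh hq)
      linarith [h.skew_right y p, h.skew_right q p]
    have hspq : s p q = u := hsP p hp q hqW (fun hh => hPQ q hh hq)
    have hpV := hWs hpW
    have hqV := hWs hqW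
    -- a vertex strictly between `P` and `Q` is not reversed against both
    have hmid : ∀ w ∈ W, w ∉ P → w ∉ Q → t p w ≠ s p w → t w q ≠ s w q → False := by
      intro w hw hwP hwQ e1 e2
      have hwV := hWs hw
      have := h.eq_of_isolated_neg hpV hqV hwV (hne p q hspq hpq) (two p hpV w hwV e1)
        (h.eq_neg_symm (two w hwV q hqV e2))
      have a1 := hsP p hp w hw hwP
      have a2 := hsQ q hq w hw hwQ
      exact hu (by linarith [h.skew_left w q])
    by_cases hvp : t v p = s v p
    · have hvq : t v q = s v q := by
        by_contra hh
        have := h.eq_of_isolated hvV hqV hpV hh hvp (h.eq_symm hpq)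
        exact hpv (by linarith [h.skew_left v p, h.skew_left q p])
      obtain ⟨w, hw, hvw⟩ := hvR
      have hwV := hWs hw
      by_cases hwP : w ∈ P
      · have := h.eq_of_isolated hvV hwV hqV hvw hvq (hPQe w hwP q hq)
        exact hqv (by rw [this, hsP w hwP q hqW (fun hh => hPQ q hh hq)])
      by_cases hwQ : w ∈ Q
      · have := h.eq_of_isolated hvV hwV hpV hvw hvp (h.eq_symm (hPQe p hp w hwQ))
        exact hpv (by linarith [h.skew_left v p, h.skew_left w p, hsP p hp w hw hwP])
      have a1 := hsP p hp w hw hwP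
      have a2 := hsQ q hq w hw hwQ
      refine hmid w hw hwP hwQ (fun e => ?_) (fun e => ?_)
      · have := h.eq_of_isolated hvV hwV hpV hvw hvp (h.eq_symm e)
        exact hpv (by linarith [h.skew_left v p, h.skew_left w p])
      · have := h.eq_of_isolated hvV hwV hqV hvw hvq e
        exact hqv (by linarith)
    -- now `v p` and `v q` are reversed, and `v` sees `p` and `q` in the same way
    have hvp' := two v hvV p hpV hvp
    have hsvp : s v p ≠ 0 := fun h0 => hvp (by rw [hvp', h0, neg_zero])
    have hvq : t v q ≠ s v q := by
      intro hh
      have := h.eq_of_isolated hvV hpV hqV hvp hh hpq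
      exact hqv (by linarith)
    have hvq' := two v hvV q hqV hvq
    have hpvqv : s p v = s q v := h.eq_of_isolated_neg hpV hqV hvV (hne p q hspq hpq)
      (h.eq_neg_symm hvp') (h.eq_neg_symm hvq')
    have k1 := h.skew_left v p
    have k2 := h.skew_left v q
    have hmidR : ∀ w ∈ W, w ∉ P → w ∉ Q → t v w ≠ s v w ∧ s w v = s p v := by
      intro w hw hwP hwQ
      have hwV := hWs hw
      have a1 := hsP p hp w hw hwP
      have a2 := hsQ q hq w hw hwQ
      have k3 := h.skew_left v w
      have k4 := h.skew_left p w
      have k5 := h.skew_left w q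
      have hR' : t v w ≠ s v w := by
        intro hh
        by_cases e1 : t p w = s p w
        · have b1 := h.eq_of_isolated hvV hpV hwV hvp hh e1
          by_cases e2 : t w q = s w q
          · have b2 := h.eq_of_isolated hvV hqV hwV hvq hh (h.eq_symm e2)
            exact hu (by linarith)
          · have e2' := two w hwV q hqV e2
            have hvw0 : t v w ≠ -s v w := by
              intro e3
              exact hu (by linarith)
            have b2 := h.eq_of_isolated_neg hvV hwV hqV hvw0 hvq' e2'
            exact hqv (by linarith)
        · by_cases e2 : t w q = s w q
          · have b1 := h.eq_of_isolated hvV hqV hwV hvq hh (h.eq_symm e2)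
            have e1' := two p hpV w hwV e1
            have hvw0 : t v w ≠ -s v w := by
              intro e3
              exact hu (by linarith)
            have b2 := h.eq_of_isolated_neg hvV hwV hpV hvw0 hvp' (h.eq_neg_symm e1')
            exact hpv (by linarith)
          · exact hmid w hw hwP hwQ e1 e2
      refine ⟨hR', ?_⟩
      have hR'' := h.eq_neg_symm (two v hvV w hwV hR')
      by_cases e1 : t p w = s p w
      · exact (h.eq_of_isolated_neg hpV hwV hvV (hne p w a1 e1) (h.eq_neg_symm hvp') hR'').symm
      · have e2 : t w q = s w q := by
          by_contra hh
          exact hmid w hw hwP hwQ e1 hh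
        rw [hpvqv]
        exact h.eq_of_isolated_neg hwV hqV hvV (hne w q a2 e2) hR'' (h.eq_neg_symm hvq')
    obtain ⟨z, hz, hvz⟩ := hvE
    have hzV := hWs hz
    have hvz' := two' v hvV z hzV hvz
    by_cases hzP : z ∈ P
    · obtain ⟨x, hx, w, hw, hwP, hxw⟩ := hR P hPW hP.2.1 hP.2.2.1
      have hwQ : w ∉ Q := fun hh => hxw (hPQe x hx w hh)
      have hwV := hWs hw
      have a0 := hsP x hx w hw hwP
      have a1 := hsP z hzP w hw hwP
      have hzw : t z w = -s z w := by
        rw [hcP z hzP x hx w hw hwP, two x (hWs (hPW hx)) w hwV hxw, a0, a1]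
      obtain ⟨b1, b2⟩ := hmidR w hw hwP hwQ
      have := h.eq_of_isolated_neg hvV hzV hwV hvz (two v hvV w hwV b1) hzw
      have b3 := h.skew_left z v
      have b4 := h.skew_left v w
      exact hqv (by linarith)
    by_cases hzQ : z ∈ Q
    · obtain ⟨x, hx, w, hw, hwQ, hxw⟩ := hR Q hQW hQ.2.1 hQ.2.2.1
      have hwP : w ∉ P := fun hh => hxw (h.eq_symm (hPQe w hh x hx))
      have hwV := hWs hw
      have a0 := hsQ x hx w hw hwQ
      have a1 := hsQ z hzQ w hw hwQ
      have hzw : t z w = -s z w := by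
        rw [hcQ z hzQ x hx w hw hwQ, two x (hWs (hQW hx)) w hwV hxw, h.skew_left w x,
          h.skew_left w z, a0, a1]
      obtain ⟨b1, b2⟩ := hmidR w hw hwP hwQ
      have := h.eq_of_isolated_neg hvV hzV hwV hvz (two v hvV w hwV b1) hzw
      have b4 := h.skew_left v w
      have b5 := h.skew_left w z
      exact hpv (by linarith)
    · exact (hmidR z hz hzP hzQ).1 hvz'
  rcases h.two p (hWs (hPW hp)) q (hWs (hQW hq)) with e | e
  · exact key t h hR hvR hvE hcP hcQ e
  · refine key (fun i j => -t i j) h.neg_right ?_ ?_ ?_ ?_ ?_ ?_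
    · simpa only [neg_eq_iff_eq_neg, ne_eq] using hE
    · simpa only [neg_eq_iff_eq_neg, ne_eq] using hvE
    · simpa only [neg_inj, ne_eq] using hvR
    · exact fun i hi j hj k hk hkP => congrArg _ (hcP i hi j hj k hk hkP)
    · exact fun i hi j hj k hk hkP => congrArg _ (hcQ i hi j hj k hk hkP)
    · simp only [e, neg_neg]

end Fronts

/-! ### Common clans of skew arrays -/

section CommonClan

variable {ι : Type*} {V : Finset ι} {s t : ι → ι → ℝ}

/-- A maximal set `W` on which both graphs are connected and `s` has a front is all of `V` or, since
no vertex outside it has neighbours of both kinds in it, a common clan. -/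
theorem MinorTwins.exists_common_clan_or_front (h : MinorTwins V s t) (hcard : 2 ≤ V.card) :
    (∀ i ∈ V, ∀ j ∈ V, t i j = s i j) ∨ (∀ i ∈ V, ∀ j ∈ V, t i j = -s i j) ∨
      (∃ X ⊆ V, 2 ≤ X.card ∧ X ≠ V ∧ IsClanIn s V X ∧ IsClanIn t V X) ∨
      ∃ u, u ≠ 0 ∧ ∃ P, IsFront s u V P := by
  classical
  by_cases hR : ConnectedOn (fun i j => t i j ≠ s i j) V
  swap
  · rcases h.exists_common_clan_of_not_connectedOn hR with h1 | h1
    · exact Or.inl h1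
    · exact Or.inr (Or.inr (Or.inl h1))
  by_cases hE : ConnectedOn (fun i j => t i j ≠ -s i j) V
  swap
  · rcases h.neg_right.exists_common_clan_of_not_connectedOn
      (by simpa only [neg_eq_iff_eq_neg, ne_eq] using hE) with h1 | ⟨X, h1, h2, h3, h4, h5⟩
    · exact Or.inr (Or.inl fun i hi j hj => neg_eq_iff_eq_neg.mp (h1 i hi j hj))
    · exact Or.inr (Or.inr (Or.inl ⟨X, h1, h2, h3, h4,
        fun i hi j hj k hk hkX => neg_inj.mp (h5 i hi j hj k hk hkX)⟩))
  obtain ⟨W₀, hW₀V, hW₀R, hW₀E, u, hu, hW₀F⟩ := h.exists_front_of_connectedOn hcard hR hE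
  obtain ⟨W, hW, hmax⟩ := Finset.exists_max_image (V.powerset.filter fun W =>
      ConnectedOn (fun i j => t i j ≠ s i j) W ∧ ConnectedOn (fun i j => t i j ≠ -s i j) W ∧
      ∃ P, IsFront s u W P) Finset.card ⟨W₀, by simp [hW₀V, hW₀R, hW₀E, hW₀F]⟩
  simp only [Finset.mem_filter, Finset.mem_powerset] at hW hmax
  obtain ⟨hWV, hWR, hWE, hWF⟩ := hW
  by_cases hWe : W = V
  · exact Or.inr (Or.inr (Or.inr ⟨u, hu, hWe ▸ hWF⟩))
  have hWcard : 2 ≤ W.card := by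
    obtain ⟨P, hP1, hP2, hP3, -⟩ := hWF
    have := Finset.card_pos.mpr hP2
    have := Finset.card_lt_card (hP1.ssubset_of_ne hP3)
    omega
  have hside : ∀ k ∈ V, k ∉ W →
      (∀ w ∈ W, t k w = s k w) ∨ (∀ w ∈ W, t k w = -s k w) := by
    intro k hk hkW
    by_contra hno
    push Not at hno
    obtain ⟨⟨w, hw, hkw⟩, ⟨z, hz, hkz⟩⟩ := hno
    have hins : insert k W ⊆ V := Finset.insert_subset hk hWV
    have hF := (h.mono hins).exists_front_insert hu hkW hWR hWE ⟨w, hw, hkw⟩ ⟨z, hz, hkz⟩ hWF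
    have := hmax (insert k W) ⟨hins,
      hWR.insert (fun x y hh e => hh (h.eq_symm e)) hw hkw,
      hWE.insert (fun x y hh e => hh (h.eq_neg_symm e)) hz hkz, hF⟩
    rw [Finset.card_insert_of_notMem hkW] at this
    omega
  have hclan : IsClanIn s V W := by
    intro i hi j hj k hk hkW
    rcases hside k hk hkW with e | e
    · exact hWR.const (f := fun x => s x k) (fun x hx y hy hxy => h.eq_of_isolated (hWV hx)
        (hWV hy) hk hxy (h.eq_symm (e x hx)) (h.eq_symm (e y hy))) hi hj
    · exact hWE.const (f := fun x => s x k) (fun x hx y hy hxy => h.eq_of_isolated_neg (hWV hx)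
        (hWV hy) hk hxy (h.eq_neg_symm (e x hx)) (h.eq_neg_symm (e y hy))) hi hj
  refine Or.inr (Or.inr (Or.inl ⟨W, hWV, hWcard, hWe, hclan, ?_⟩))
  intro i hi j hj k hk hkW
  rcases hside k hk hkW with e | e
  · rw [h.eq_symm (e i hi), h.eq_symm (e j hj), hclan i hi j hj k hk hkW]
  · rw [h.eq_neg_symm (e i hi), h.eq_neg_symm (e j hj), hclan i hi j hj k hk hkW]

/-- The alternatives for `MinorTwins`: equal, opposite, a nontrivial common clan, or a vertex `p`
that is a front of `s`. -/
theorem MinorTwins.exists_common_clan_or_top (h : MinorTwins V s t) :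
    (∀ i ∈ V, ∀ j ∈ V, t i j = s i j) ∨ (∀ i ∈ V, ∀ j ∈ V, t i j = -s i j) ∨
      (∃ X ⊆ V, 2 ≤ X.card ∧ X ≠ V ∧ IsClanIn s V X ∧ IsClanIn t V X) ∨
      (2 < V.card ∧ ∃ u, u ≠ 0 ∧ ∃ p ∈ V, ∀ q ∈ V, q ≠ p → s p q = u) := by
  classical
  by_cases h1 : V.card ≤ 1
  · left
    intro i hi j hj
    rw [Finset.card_le_one.mp h1 i hi j hj]
    linarith [h.skew_left j j, h.skew_right j j]
  by_cases h2 : V.card = 2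
  · obtain ⟨x, y, hxy, rfl⟩ := Finset.card_eq_two.mp h2
    have a1 := h.skew_left x x
    have a2 := h.skew_right x x
    have a3 := h.skew_left y y
    have a4 := h.skew_right y y
    have a5 := h.skew_left x y
    have a6 := h.skew_right x y
    rcases h.two x (by simp) y (by simp) with e | e
    · left
      simp only [Finset.mem_insert, Finset.mem_singleton]
      rintro i (rfl | rfl) j (rfl | rfl) <;> linarith
    · right; left
      simp only [Finset.mem_insert, Finset.mem_singleton]
      rintro i (rfl | rfl) j (rfl | rfl) <;> linarith
  rcases h.exists_common_clan_or_front (by omega) with e | e | e | ⟨u, hu, P, hP⟩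
  · exact Or.inl e
  · exact Or.inr (Or.inl e)
  · exact Or.inr (Or.inr (Or.inl e))
  obtain ⟨P, hP, hmin⟩ := hP.exists_minimal
  by_cases hPc : 2 ≤ P.card
  · refine Or.inr (Or.inr (Or.inl ⟨P, hP.1, hPc, hP.2.2.1, ?_,
      h.isClanIn_of_minimal_front hu hP hmin⟩))
    intro i hi j hj k hk hkP
    rw [hP.2.2.2 i hi k hk hkP, hP.2.2.2 j hj k hk hkP]
  · have hPpos := Finset.card_pos.mpr hP.2.1
    obtain ⟨p, rfl⟩ := Finset.card_eq_one.mp (show P.card = 1 by omega)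
    refine Or.inr (Or.inr (Or.inr ⟨by omega, u, hu, p, hP.1 (by simp), ?_⟩))
    intro q hq hqp
    exact hP.2.2.2 p (by simp) q hq (by simpa using hqp)

/-- If `p` is a front of `s` for the value `u`, then `p` together with the elements above it in `t`
forms a clan of `t`. -/
theorem MinorTwins.isClanIn_above_top [DecidableEq ι] (h : MinorTwins V s t) {u : ℝ} (hu : u ≠ 0)
    {p : ι} (hp : p ∈ V) (htop : ∀ q ∈ V, q ≠ p → s p q = u) :
    IsClanIn t V (V.filter fun q => q = p ∨ t p q = -u) := by
  have key : ∀ i ∈ V, (i = p ∨ t p i = -u) → ∀ k ∈ V, ¬(k = p ∨ t p k = -u) → t i k = u := by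
    intro i hi hi' k hk hk'
    push Not at hk'
    have hpk : t p k = u := by
      rw [← htop k hk hk'.1] at hk' ⊢
      exact (h.two p hp k hk).resolve_right hk'.2
    by_cases hip : i = p
    · rw [hip, hpk]
    have hpi := hi'.resolve_left hip
    have h3 := h.three p hp i hi k hk
    rw [h.skew_left p k, h.skew_right p k, htop i hi hip, htop k hk hk'.1, hpk, hpi] at h3
    have : u * (t i k - u) = 0 := by linarith
    linarith [(mul_eq_zero.mp this).resolve_left hu]
  intro i hi j hj k hk hkX
  simp only [Finset.mem_filter] at hi hj hkX
  have hk' : ¬(k = p ∨ t p k = -u) := fun hh => hkX ⟨hk, hh⟩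
  rw [key i hi.1 hi.2 k hk hk', key j hj.1 hj.2 k hk hk']

end CommonClan

/-! ### Clan inversion preserves principal minors -/

open Matrix in
/-- The determinant of a block matrix whose off-diagonal blocks are constant along the first index
set depends on the first diagonal block `P` only through `det P` and the sum of the entries of
`adjugate P`, hence is unchanged when `P` is transposed. For invertible `P` this is the Schur
complement formula; the general case follows by replacing `P` with `P + x • 1` and letting
`x → 0`. -/
theorem Matrix.det_fromBlocks_transpose_of_const {m n : Type*} [Fintype m] [Fintype n]
    [DecidableEq m] [DecidableEq n] (P : Matrix m m ℝ) (v w : n → ℝ) (Q : Matrix n n ℝ) :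
    (fromBlocks Pᵀ (of fun _ k => v k) (of fun k _ => w k) Q).det =
      (fromBlocks P (of fun _ k => v k) (of fun k _ => w k) Q).det := by
  have hinv : ∀ N : Matrix m m ℝ, N.det ≠ 0 →
      (fromBlocks Nᵀ (of fun _ k => v k) (of fun k _ => w k) Q).det =
        (fromBlocks N (of fun _ k => v k) (of fun k _ => w k) Q).det := by
    intro N hN
    have hNu : IsUnit N.det := isUnit_iff_ne_zero.mpr hN
    have hNu' : IsUnit Nᵀ.det := by rwa [det_transpose]
    let _ := invertibleOfIsUnitDet N hNu
    let _ := invertibleOfIsUnitDet Nᵀ hNu'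
    rw [det_fromBlocks₁₁, det_fromBlocks₁₁, det_transpose]
    congr 2
    rw [invOf_eq_nonsing_inv, invOf_eq_nonsing_inv, ← transpose_nonsing_inv]
    congr 1
    ext i j
    simp only [mul_apply, of_apply, transpose_apply, Finset.sum_mul]
    rw [Finset.sum_comm]
  have hc : ∀ N : Matrix m m ℝ, Continuous fun x : ℝ =>
      (fromBlocks (N + x • (1 : Matrix m m ℝ)) (of fun _ k => v k) (of fun k _ => w k) Q).det := by
    intro N
    fun_prop
  have hroots : ∀ᶠ x : ℝ in nhdsWithin 0 {0}ᶜ, (P + x • (1 : Matrix m m ℝ)).det ≠ 0 := by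
    have hfin : {x : ℝ | (-P).charpoly.IsRoot x}.Finite :=
      Polynomial.finite_setOfPred_isRoot (charpoly_monic _).ne_zero
    filter_upwards [hfin.eventually_cofinite_notMem.filter_mono (nhdsNE_le_cofinite 0)]
      with x hx h0
    refine hx ?_
    show (-P).charpoly.eval x = 0
    rw [eval_charpoly, ← h0]
    congr 1
    rw [sub_neg_eq_add, add_comm, smul_one_eq_diagonal]
    rfl
  have h1 := ((hc Pᵀ).tendsto 0).mono_left (nhdsWithin_le_nhds (s := {0}ᶜ))
  have h2 := ((hc P).tendsto 0).mono_left (nhdsWithin_le_nhds (s := {0}ᶜ))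
  have h3 := tendsto_nhds_unique (h1.congr' (hroots.mono fun x hx => by
    rw [← hinv _ hx, transpose_add, transpose_smul, transpose_one])) h2
  simpa using h3


/-- Transposing the block of a square matrix indexed by a clan preserves the determinant. -/
theorem Matrix.det_transpose_clan {ι : Type*} [Fintype ι] [DecidableEq ι] (M : Matrix ι ι ℝ)
    (p : ι → Prop) [DecidablePred p]
    (hp : ∀ i j k, p i → p j → ¬p k → M i k = M j k ∧ M k i = M k j) :
    (Matrix.of fun i j => if p i ∧ p j then M j i else M i j).det = M.det := by
  by_cases hne : ∃ x, p x
  swap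
  · push Not at hne
    congr 1
    ext i j
    simp [hne]
  obtain ⟨x, hx⟩ := hne
  rw [← Matrix.det_submatrix_equiv_self (Equiv.sumCompl p),
    ← Matrix.det_submatrix_equiv_self (Equiv.sumCompl p) M]
  let e := Equiv.sumCompl p
  have key := Matrix.det_fromBlocks_transpose_of_const (M.submatrix e e).toBlocks₁₁
    (fun k : {a // ¬p a} => M x k) (fun k : {a // ¬p a} => M k x) (M.submatrix e e).toBlocks₂₂
  have e1 : M.submatrix e e = Matrix.fromBlocks (M.submatrix e e).toBlocks₁₁
      (Matrix.of fun _ (k : {a // ¬p a}) => M x k) (Matrix.of fun (k : {a // ¬p a}) _ => M k x)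
      (M.submatrix e e).toBlocks₂₂ := by
    ext (i | i) (j | j)
    · rfl
    · exact (hp i x j i.2 hx j.2).1
    · exact (hp j x i j.2 hx i.2).2
    · rfl
  have e2 : (Matrix.of fun i j => if p i ∧ p j then M j i else M i j).submatrix e e =
      Matrix.fromBlocks (M.submatrix e e).toBlocks₁₁.transpose
      (Matrix.of fun _ (k : {a // ¬p a}) => M x k) (Matrix.of fun (k : {a // ¬p a}) _ => M k x)
      (M.submatrix e e).toBlocks₂₂ := by
    ext (i | i) (j | j)
    · simp [e, i.2, j.2, Matrix.toBlocks₁₁]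
    · simpa [e, i.2, j.2] using (hp i x j i.2 hx j.2).1
    · simpa [e, i.2, j.2] using (hp j x i j.2 hx i.2).2
    · simp [e, i.2, j.2, Matrix.toBlocks₂₂]
  rw [e2, key]
  exact congrArg Matrix.det e1.symm

/-- Inverting `X` preserves the principal minor on `Y` as soon as no element of `Y` outside `X`
separates `X`. -/
theorem principalMinor_invOn {n : ℕ} (M : Matrix (Fin n) (Fin n) ℝ) (X Y : Finset (Fin n))
    (h : ∀ i ∈ X, ∀ j ∈ X, ∀ k ∈ Y, k ∉ X → M i k = M j k ∧ M k i = M k j) :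
    principalMinor (invOn M X) Y = principalMinor M Y :=
  Matrix.det_transpose_clan (M.submatrix (fun i : Y => (i : Fin n)) (fun i : Y => (i : Fin n)))
    (fun i => (i : Fin n) ∈ X) (fun i j k hi hj hk => h i hi j hj k k.2 hk)

/-! ### Generalized tournament matrices and their small minors -/

section GenTournament

variable {n : ℕ} {M A B : Matrix (Fin n) (Fin n) ℝ} {V X : Finset (Fin n)}

/-- The skew array `M - Mᵀ`. A generalized tournament matrix is `(J - I + s) / 2` with `s` its skew
array. -/
def skewPart (M : Matrix (Fin n) (Fin n) ℝ) (i j : Fin n) : ℝ := M i j - M j i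

theorem skewPart_skew (M : Matrix (Fin n) (Fin n) ℝ) (i j : Fin n) :
    skewPart M j i = -skewPart M i j := by
  unfold skewPart; ring

theorem skewPart_invOn (M : Matrix (Fin n) (Fin n) ℝ) (X : Finset (Fin n)) (i j : Fin n) :
    skewPart (invOn M X) i j = if i ∈ X ∧ j ∈ X then skewPart M j i else skewPart M i j := by
  unfold skewPart invOn
  by_cases hi : i ∈ X <;> by_cases hj : j ∈ X <;> simp [hi, hj]

theorem IsGenTournament.add_eq (hM : IsGenTournament M) {i j : Fin n} (hij : i ≠ j) :
    M i j + M j i = 1 := by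
  have := congrFun (congrFun hM.2 i) j
  simpa [Matrix.one_apply, hij] using this

theorem IsGenTournament.diag (hM : IsGenTournament M) (i : Fin n) : M i i = 0 := by
  have := congrFun (congrFun hM.2 i) i
  simp only [Matrix.add_apply, Matrix.transpose_apply, Matrix.sub_apply, Matrix.of_apply,
    Matrix.one_apply_eq] at this
  linarith

theorem IsGenTournament.invOn (hM : IsGenTournament M) (X : Finset (Fin n)) :
    IsGenTournament (invOn M X) := by
  refine ⟨fun i j => ?_, ?_⟩
  · simp only [_root_.invOn, Matrix.of_apply]
    split_ifs
    · exact hM.1 j i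
    · exact hM.1 i j
  · rw [← hM.2]
    ext i j
    by_cases hi : i ∈ X <;> by_cases hj : j ∈ X <;> simp [_root_.invOn, hi, hj, add_comm]

theorem IsGenTournament.eq_of_skewPart (hA : IsGenTournament A) (hB : IsGenTournament B)
    {i j : Fin n} (h : skewPart A i j = skewPart B i j) : A i j = B i j := by
  by_cases hij : i = j
  · rw [hij, hA.diag, hB.diag]
  · have h1 := hA.add_eq hij
    have h2 := hB.add_eq hij
    unfold skewPart at h
    linarith

theorem IsGenTournament.clan_of_isClanIn (hM : IsGenTournament M)
    (h : IsClanIn (skewPart M) V X) :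
    ∀ i ∈ X, ∀ j ∈ X, ∀ k ∈ V, k ∉ X → M i k = M j k ∧ M k i = M k j := by
  intro i hi j hj k hk hkX
  have e := h i hi j hj k hk hkX
  have h1 := hM.add_eq (i := i) (j := k) (fun e => hkX (e ▸ hi))
  have h2 := hM.add_eq (i := j) (j := k) (fun e => hkX (e ▸ hj))
  unfold skewPart at e
  constructor <;> linarith

theorem principalMinor_image {k : ℕ} (M : Matrix (Fin n) (Fin n) ℝ) (f : Fin k → Fin n)
    (hf : Function.Injective f) :
    principalMinor M (Finset.univ.image f) = (M.submatrix f f).det := by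
  let e : Fin k ≃ (Finset.univ.image f : Finset (Fin n)) :=
    Equiv.ofBijective (fun i => ⟨f i, by simp⟩) ⟨fun i j h => hf (Subtype.ext_iff.mp h), by
      rintro ⟨y, hy⟩
      obtain ⟨i, -, rfl⟩ := Finset.mem_image.mp hy
      exact ⟨i, rfl⟩⟩
  unfold principalMinor
  rw [← Matrix.det_submatrix_equiv_self e]
  rfl

theorem det_submatrix_eq_of_minors {k : ℕ} (hk : 0 < k) (hk4 : k ≤ 4)
    (h : ∀ X ⊆ V, X.Nonempty → X.card ≤ 4 → principalMinor A X = principalMinor B X)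
    (f : Fin k → Fin n) (hf : Function.Injective f) (hfV : ∀ i, f i ∈ V) :
    (A.submatrix f f).det = (B.submatrix f f).det := by
  rw [← principalMinor_image A f hf, ← principalMinor_image B f hf]
  refine h _ ?_ ⟨f ⟨0, hk⟩, by simp⟩ ?_
  · intro x hx
    obtain ⟨i, -, rfl⟩ := Finset.mem_image.mp hx
    exact hfV i
  · rw [Finset.card_image_of_injective _ hf]
    simpa using hk4

theorem det_fin_four_of_diag_zero (M : Matrix (Fin 4) (Fin 4) ℝ) (h : ∀ i, M i i = 0) :
    M.det = M 0 1 * M 1 0 * (M 2 3 * M 3 2) + M 0 2 * M 2 0 * (M 1 3 * M 3 1)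
      + M 0 3 * M 3 0 * (M 1 2 * M 2 1)
      - M 0 1 * M 1 2 * M 2 3 * M 3 0 - M 0 3 * M 3 2 * M 2 1 * M 1 0
      - M 0 1 * M 1 3 * M 3 2 * M 2 0 - M 0 2 * M 2 3 * M 3 1 * M 1 0
      - M 0 2 * M 2 1 * M 1 3 * M 3 0 - M 0 3 * M 3 1 * M 1 2 * M 2 0 := by
  have h0 := h 0
  have h1 := h 1
  have h2 := h 2
  have h3 := h 3
  rw [Matrix.det_succ_row_zero]
  simp [Fin.sum_univ_succ, Matrix.det_fin_three, Fin.succAbove, h0, h1, h2, h3]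
  ring

theorem minorTwins_of_minors (hA : IsGenTournament A) (hB : IsGenTournament B)
    (h : ∀ X ⊆ V, X.Nonempty → X.card ≤ 4 → principalMinor A X = principalMinor B X) :
    MinorTwins V (skewPart A) (skewPart B) := by
  have h2 : ∀ i ∈ V, ∀ j ∈ V, skewPart B i j = skewPart A i j ∨
      skewPart B i j = -skewPart A i j := by
    intro i hi j hj
    by_cases hij : i = j
    · left
      simp [hij, skewPart]
    have hd := det_submatrix_eq_of_minors (by norm_num) (by norm_num) h ![i, j]
      (by simp [Function.Injective, Fin.forall_fin_succ, hij, Ne.symm hij])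
      (by simp [Fin.forall_fin_succ, hi, hj])
    simp only [Matrix.det_fin_two, Matrix.submatrix_apply, Matrix.cons_val_zero,
      Matrix.cons_val_one, hA.diag, hB.diag] at hd
    have a1 := hA.add_eq hij
    have a2 := hB.add_eq hij
    rw [← sq_eq_sq_iff_eq_or_eq_neg]
    unfold skewPart
    have a3 : A j i = 1 - A i j := by linarith
    have a4 : B j i = 1 - B i j := by linarith
    rw [a3, a4] at hd ⊢
    linear_combination (-4) * hd
  have hsq : ∀ i ∈ V, ∀ j ∈ V, skewPart B i j ^ 2 = skewPart A i j ^ 2 := fun i hi j hj =>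
    sq_eq_sq_iff_eq_or_eq_neg.mpr (h2 i hi j hj)
  have hself : ∀ (M : Matrix (Fin n) (Fin n) ℝ) i, skewPart M i i = 0 := by simp [skewPart]
  have h3 : ∀ i ∈ V, ∀ j ∈ V, ∀ k ∈ V,
      skewPart B i j * skewPart B j k + skewPart B j k * skewPart B k i +
          skewPart B k i * skewPart B i j =
        skewPart A i j * skewPart A j k + skewPart A j k * skewPart A k i +
          skewPart A k i * skewPart A i j := by
    intro i hi j hj k hk
    by_cases hij : i = j
    · subst hij
      rw [skewPart_skew A i k, skewPart_skew B i k, hself, hself]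
      linear_combination -hsq i hi k hk
    by_cases hik : i = k
    · subst hik
      rw [skewPart_skew A i j, skewPart_skew B i j, hself, hself]
      linear_combination -hsq i hi j hj
    by_cases hjk : j = k
    · subst hjk
      rw [skewPart_skew A i j, skewPart_skew B i j, hself, hself]
      linear_combination -hsq i hi j hj
    have hd := det_submatrix_eq_of_minors (by norm_num) (by norm_num) h ![i, j, k]
      (by simp [Function.Injective, Fin.forall_fin_succ, hij, Ne.symm hij, hik, Ne.symm hik, hjk,
        Ne.symm hjk])
      (by simp [Fin.forall_fin_succ, hi, hj, hk])
    rw [Matrix.det_fin_three, Matrix.det_fin_three] at hd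
    simp only [Matrix.submatrix_apply, Matrix.cons_val, hA.diag, hB.diag] at hd
    have a1 : A j i = 1 - A i j := by linarith [hA.add_eq hij]
    have a2 : A k i = 1 - A i k := by linarith [hA.add_eq hik]
    have a3 : A k j = 1 - A j k := by linarith [hA.add_eq hjk]
    have b1 : B j i = 1 - B i j := by linarith [hB.add_eq hij]
    have b2 : B k i = 1 - B i k := by linarith [hB.add_eq hik]
    have b3 : B k j = 1 - B j k := by linarith [hB.add_eq hjk]
    unfold skewPart
    rw [a1, a2, a3, b1, b2, b3] at hd ⊢
    linear_combination (-4) * hd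
  refine ⟨skewPart_skew A, skewPart_skew B, h2, h3, ?_⟩
  intro i hi j hj k hk l hl hij hik hil hjk hjl hkl
  have hd := det_submatrix_eq_of_minors (by norm_num) (by norm_num) h ![i, j, k, l]
    (by simp [Function.Injective, Fin.forall_fin_succ, hij, Ne.symm hij, hik, Ne.symm hik, hjk,
        Ne.symm hjk, hil, Ne.symm hil, hjl, Ne.symm hjl, hkl, Ne.symm hkl])
    (by simp [Fin.forall_fin_succ, hi, hj, hk, hl])
  rw [det_fin_four_of_diag_zero _ (fun i => hA.diag _),
    det_fin_four_of_diag_zero _ (fun i => hB.diag _)] at hd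
  simp only [Matrix.submatrix_apply, Matrix.cons_val] at hd
  have t1 := h3 i hi j hj k hk
  have t2 := h3 i hi j hj l hl
  have t3 := h3 i hi k hk l hl
  have t4 := h3 j hj k hk l hl
  have s1 := hsq i hi j hj
  have s2 := hsq i hi k hk
  have s3 := hsq i hi l hl
  have s4 := hsq j hj k hk
  have s5 := hsq j hj l hl
  have s6 := hsq k hk l hl
  have a1 : A j i = 1 - A i j := by linarith [hA.add_eq hij]
  have a2 : A k i = 1 - A i k := by linarith [hA.add_eq hik]
  have a3 : A k j = 1 - A j k := by linarith [hA.add_eq hjk]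
  have a4 : A l i = 1 - A i l := by linarith [hA.add_eq hil]
  have a5 : A l j = 1 - A j l := by linarith [hA.add_eq hjl]
  have a6 : A l k = 1 - A k l := by linarith [hA.add_eq hkl]
  have b1 : B j i = 1 - B i j := by linarith [hB.add_eq hij]
  have b2 : B k i = 1 - B i k := by linarith [hB.add_eq hik]
  have b3 : B k j = 1 - B j k := by linarith [hB.add_eq hjk]
  have b4 : B l i = 1 - B i l := by linarith [hB.add_eq hil]
  have b5 : B l j = 1 - B j l := by linarith [hB.add_eq hjl]
  have b6 : B l k = 1 - B k l := by linarith [hB.add_eq hkl]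
  have pair : ∀ x y z w : ℝ, x ^ 2 = y ^ 2 → z ^ 2 = w ^ 2 →
      (1 - x ^ 2) * (1 - z ^ 2) = (1 - y ^ 2) * (1 - w ^ 2) := by
    intro x y z w e1 e2
    rw [e1, e2]
  have p1 := pair _ _ _ _ s1 s6
  have p2 := pair _ _ _ _ s2 s5
  have p3 := pair _ _ _ _ s3 s4
  clear s1 s2 s3 s4 s5 s6 pair
  unfold skewPart at *
  simp only [a1, a2, a3, a4, a5, a6, b1, b2, b3, b4, b5, b6] at hd t1 t2 t3 t4 p1 p2 p3 ⊢
  -- sixteen times the minor is the sum of the products `(1 - s_ij²) (1 - s_kl²)`, minus `6`, minus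
  -- twice the sum of the cubic invariants, minus twice the quartic one
  linear_combination 8 * hd - t1 - t2 - t3 - t4 + (1 / 2) * (p1 + p2 + p3)

end GenTournament

/-! ### Sequences of clan inversions inside a vertex set -/

section ClanSteps

variable {n : ℕ} {M N A B : Matrix (Fin n) (Fin n) ℝ} {V X : Finset (Fin n)}

/-- `N` arises from `M` by inverting a clan of the restriction of `M` to `V`. The clan condition is
expressed by the skew array, which for generalized tournament matrices is equivalent. -/
def ClanStep (V : Finset (Fin n)) (M N : Matrix (Fin n) (Fin n) ℝ) : Prop :=
  ∃ X ⊆ V, IsClanIn (skewPart M) V X ∧ N = invOn M X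

theorem isGenTournament_of_steps (h : Relation.ReflTransGen (ClanStep V) M N)
    (hM : IsGenTournament M) : IsGenTournament N := by
  induction h with
  | refl => exact hM
  | tail _ hstep ih =>
    obtain ⟨X, -, -, rfl⟩ := hstep
    exact ih.invOn X

theorem principalMinor_of_steps (h : Relation.ReflTransGen (ClanStep V) M N)
    (hM : IsGenTournament M) {Y : Finset (Fin n)} (hY : Y ⊆ V) :
    principalMinor N Y = principalMinor M Y := by
  induction h with
  | refl => rfl
  | tail hsteps hstep ih =>
    obtain ⟨X, -, hX, rfl⟩ := hstep
    rw [← ih]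
    exact principalMinor_invOn _ _ _ fun i hi j hj k hk hkX =>
      (isGenTournament_of_steps hsteps hM).clan_of_isClanIn hX i hi j hj k (hY hk) hkX

/-- A sequence of clan inversions on the quotient by a clan `X`, realized on the representatives
outside `X` together with one `x ∈ X`, lifts to `V`: an inverted clan is replaced by its preimage
under the contraction `ρ` of `X` to `x`. -/
theorem steps_lift_contraction {x : Fin n} (hx : x ∈ X)
    (hclan : IsClanIn (skewPart A) V X) {ρ : Fin n → Fin n}
    (hρ : ∀ i, ρ i = if i ∈ X then x else i)
    (h : Relation.ReflTransGen (ClanStep (insert x (V \ X))) A N) :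
    ∃ N', Relation.ReflTransGen (ClanStep V) A N' ∧
      ∀ i ∈ V, ∀ j ∈ V, ρ i ≠ ρ j → skewPart N' i j = skewPart N (ρ i) (ρ j) := by
  have hρV : ∀ i ∈ V, ρ i ∈ insert x (V \ X) := by
    intro i hi
    rw [hρ]
    split_ifs with h1 <;> simp [hi, h1]
  induction h with
  | refl =>
    refine ⟨A, .refl, fun i hi j hj hij => ?_⟩
    rw [hρ, hρ] at hij ⊢
    split_ifs at hij ⊢ with h1 h2 h2
    · exact absurd rfl hij
    · exact hclan i h1 x hx j hj h2
    · rw [skewPart_skew A j i, skewPart_skew A x i, hclan j h2 x hx i hi h1]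
    · rfl
  | @tail M N _ hstep ih =>
    obtain ⟨M', hM', hM'M⟩ := ih
    obtain ⟨Y, -, hYc, rfl⟩ := hstep
    refine ⟨invOn M' (V.filter fun i => ρ i ∈ Y), hM'.tail ⟨_, Finset.filter_subset _ _, ?_, rfl⟩,
      ?_⟩
    · intro i hi j hj k hk hkY
      simp only [Finset.mem_filter] at hi hj hkY
      have hkY' : ρ k ∉ Y := fun hh => hkY ⟨hk, hh⟩
      rw [hM'M i hi.1 k hk (fun e => hkY' (e ▸ hi.2)), hM'M j hj.1 k hk (fun e => hkY' (e ▸ hj.2))]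
      exact hYc _ hi.2 _ hj.2 _ (hρV k hk) hkY'
    · intro i hi j hj hij
      rw [skewPart_invOn, skewPart_invOn]
      simp only [Finset.mem_filter, hi, hj, true_and]
      rw [hM'M i hi j hj hij, hM'M j hj i hi hij.symm]

/-- A clan inversion inside a clan `X` of `V` is a clan inversion in `V`, and changes nothing
outside the block of `X`. -/
theorem steps_of_steps_in_clan (hX : X ⊆ V) (hclan : IsClanIn (skewPart A) V X)
    (h : Relation.ReflTransGen (ClanStep X) A N) :
    Relation.ReflTransGen (ClanStep V) A N ∧
      ∀ i j, ¬(i ∈ X ∧ j ∈ X) → skewPart N i j = skewPart A i j := by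
  induction h with
  | refl => exact ⟨.refl, fun _ _ _ => rfl⟩
  | @tail M N _ hstep ih =>
    obtain ⟨hM, hMA⟩ := ih
    obtain ⟨Y, hYX, hYc, rfl⟩ := hstep
    refine ⟨hM.tail ⟨Y, hYX.trans hX, ?_, rfl⟩, ?_⟩
    · intro i hi j hj k hk hkY
      by_cases hkX : k ∈ X
      · exact hYc i hi j hj k hkX hkY
      · rw [hMA i k (fun hh => hkX hh.2), hMA j k (fun hh => hkX hh.2)]
        exact hclan i (hYX hi) j (hYX hj) k hk hkX
    · intro i j hij
      rw [skewPart_invOn, if_neg (fun hh => hij ⟨hYX hh.1, hYX hh.2⟩), hMA i j hij]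

/-- Generalized tournament matrices with the same principal minors of orders at most `4` in `V` are
connected by clan inversions. A nontrivial common clan `X` allows induction on the quotient by `X`
and on `X`; a vertex that is a front of one matrix is made one of the other by a single inversion,
after which its complement is a common clan. -/
theorem exists_steps_of_minors (hA : IsGenTournament A) (hB : IsGenTournament B)
    (h : ∀ X ⊆ V, X.Nonempty → X.card ≤ 4 → principalMinor A X = principalMinor B X) :
    ∃ N, Relation.ReflTransGen (ClanStep V) A N ∧
      ∀ i ∈ V, ∀ j ∈ V, skewPart N i j = skewPart B i j := by
  induction hn : V.card using Nat.strong_induction_on generalizing V A B with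
  | _ c ih =>
  subst hn
  have common : ∀ B : Matrix (Fin n) (Fin n) ℝ, IsGenTournament B →
      (∀ X ⊆ V, X.Nonempty → X.card ≤ 4 → principalMinor A X = principalMinor B X) →
      ∀ X ⊆ V, 2 ≤ X.card → X ≠ V → IsClanIn (skewPart A) V X → IsClanIn (skewPart B) V X →
      ∃ N, Relation.ReflTransGen (ClanStep V) A N ∧
        ∀ i ∈ V, ∀ j ∈ V, skewPart N i j = skewPart B i j := by
    clear h hB B
    intro B hB h X hXV hXcard hXne hXA hXB
    obtain ⟨x, hx⟩ : X.Nonempty := Finset.card_pos.mp (by omega)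
    have hQV : insert x (V \ X) ⊆ V := Finset.insert_subset (hXV hx) Finset.sdiff_subset
    have hQcard : (insert x (V \ X)).card < V.card := by
      have h1 := Finset.card_insert_le x (V \ X)
      have h2 := Finset.card_sdiff_add_card_eq_card hXV
      omega
    obtain ⟨N, hN, hNB⟩ := ih _ hQcard hA hB (fun Y hY => h Y (hY.trans hQV)) rfl
    obtain ⟨A', hAA', hA'N⟩ := steps_lift_contraction hx hXA (fun _ => rfl) hN
    have hA' := isGenTournament_of_steps hAA' hA
    -- `A'` agrees with `B` outside the block of `X`
    have hA'B : ∀ i ∈ V, ∀ j ∈ V, ¬(i ∈ X ∧ j ∈ X) → skewPart A' i j = skewPart B i j := by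
      intro i hi j hj hij
      by_cases hij' : i = j
      · simp [hij', skewPart]
      by_cases h1 : i ∈ X
      · have h2 : j ∉ X := fun hh => hij ⟨h1, hh⟩
        have := hA'N i hi j hj (by simp only [h1, h2, if_true, if_false]; rintro rfl; exact h2 hx)
        simp only [h1, h2, if_true, if_false] at this
        rw [this, hNB x (by simp) j (by simp [hj, h2])]
        exact hXB x hx i h1 j hj h2
      · by_cases h2 : j ∈ X
        · have := hA'N i hi j hj (by simp only [h1, h2, if_true, if_false]; rintro rfl; exact h1 hx)
          simp only [h1, h2, if_true, if_false] at this
          rw [this, hNB i (by simp [hi, h1]) x (by simp), skewPart_skew B x i, skewPart_skew B j i,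
            hXB x hx j h2 i hi h1]
        · have := hA'N i hi j hj (by simpa only [h1, h2, if_false] using hij')
          simp only [h1, h2, if_false] at this
          rw [this, hNB i (by simp [hi, h1]) j (by simp [hj, h2])]
    have hXA' : IsClanIn (skewPart A') V X := by
      intro i hi j hj k hk hkX
      rw [hA'B i (hXV hi) k hk (fun hh => hkX hh.2), hA'B j (hXV hj) k hk (fun hh => hkX hh.2)]
      exact hXB i hi j hj k hk hkX
    obtain ⟨N', hN', hN'B⟩ := ih _ (Finset.card_lt_card (hXV.ssubset_of_ne hXne)) hA' hB
      (fun Y hY hne hc => by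
        rw [principalMinor_of_steps hAA' hA (hY.trans hXV)]
        exact h Y (hY.trans hXV) hne hc) rfl
    obtain ⟨hs, hout⟩ := steps_of_steps_in_clan hXV hXA' hN'
    refine ⟨N', hAA'.trans hs, fun i hi j hj => ?_⟩
    by_cases hij : i ∈ X ∧ j ∈ X
    · exact hN'B i hij.1 j hij.2
    · rw [hout i j hij, hA'B i hi j hj hij]
  have hT := minorTwins_of_minors hA hB h
  rcases hT.exists_common_clan_or_top with e | e | ⟨X, hXV, hc, hne, hXA, hXB⟩ |
    ⟨hc, u, hu, p, hp, htop⟩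
  · exact ⟨A, .refl, fun i hi j hj => (e i hi j hj).symm⟩
  · refine ⟨invOn A V, .single ⟨V, subset_rfl, fun i _ j _ k hk hkV => absurd hk hkV, rfl⟩, ?_⟩
    intro i hi j hj
    rw [skewPart_invOn, if_pos ⟨hi, hj⟩, e i hi j hj, skewPart_skew A i j]
  · exact common B hB h X hXV hc hne hXA hXB
  · set X := V.filter fun q => q = p ∨ skewPart B p q = -u with hXdef
    have hX : IsClanIn (skewPart B) V X := hT.isClanIn_above_top hu hp htop
    have hXV : X ⊆ V := Finset.filter_subset _ _
    have hX' : IsClanIn (skewPart (invOn B X)) V X := by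
      intro i hi j hj k hk hkX
      rw [skewPart_invOn, skewPart_invOn, if_neg (fun hh => hkX hh.2),
        if_neg (fun hh => hkX hh.2)]
      exact hX i hi j hj k hk hkX
    have htop' : ∀ q ∈ V, q ≠ p → skewPart (invOn B X) p q = u := by
      intro q hq hqp
      have hpX : p ∈ X := by simp [hXdef, hp]
      rw [skewPart_invOn]
      by_cases hqu : skewPart B p q = -u
      · rw [if_pos ⟨hpX, by simp [hXdef, hq, hqu]⟩, skewPart_skew B p q, hqu, neg_neg]
      · rw [if_neg (by simp [hXdef, hqp, hqu]), ← htop q hq hqp]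
        rw [← htop q hq hqp] at hqu
        exact (hT.two p hp q hq).resolve_right hqu
    have clan_erase : ∀ s : Fin n → Fin n → ℝ, (∀ i j, s j i = -s i j) →
        (∀ q ∈ V, q ≠ p → s p q = u) → IsClanIn s V (V.erase p) := by
      intro s hs hsp i hi j hj k hk hkp
      have hkp' : k = p := by
        by_contra hh
        exact hkp (by simp [hh, hk])
      simp only [Finset.mem_erase] at hi hj
      rw [hkp', hs p i, hs p j, hsp i hi.2 hi.1, hsp j hj.2 hj.1]
    obtain ⟨N, hN, hNB⟩ := common (invOn B X) (hB.invOn X)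
      (fun Y hY hne hc => by
        rw [h Y hY hne hc]
        exact (principalMinor_invOn B X Y fun i hi j hj k hk hkX =>
          hB.clan_of_isClanIn hX i hi j hj k (hY hk) hkX).symm)
      (V.erase p) (Finset.erase_subset _ _) (by rw [Finset.card_erase_of_mem hp]; omega)
      (fun e => by rw [← e] at hp; simp at hp) (clan_erase _ (skewPart_skew A) htop)
      (clan_erase _ (skewPart_skew _) htop')
    refine ⟨invOn N X, hN.tail ⟨X, hXV, ?_, rfl⟩, ?_⟩
    · intro i hi j hj k hk hkX
      rw [hNB i (hXV hi) k hk, hNB j (hXV hj) k hk]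
      exact hX' i hi j hj k hk hkX
    · intro i hi j hj
      rw [skewPart_invOn, hNB i hi j hj, hNB j hj i hi, skewPart_invOn, skewPart_invOn]
      by_cases h1 : i ∈ X <;> by_cases h2 : j ∈ X <;> simp [h1, h2]

theorem exists_seq_of_steps (h : Relation.ReflTransGen (ClanStep Finset.univ) A B)
    (hA : IsGenTournament A) :
    ∃ (m : ℕ) (S : ℕ → Matrix (Fin n) (Fin n) ℝ),
      S 0 = A ∧ S m = B ∧ (∀ k ≤ m, IsGenTournament (S k)) ∧
      ∀ k < m, ∃ X : Finset (Fin n), IsClan (S k) X ∧ S (k + 1) = invOn (S k) X := by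
  induction h using Relation.ReflTransGen.head_induction_on with
  | refl => exact ⟨0, fun _ => B, rfl, rfl, fun _ _ => hA,
      fun k hk => absurd hk (Nat.not_lt_zero k)⟩
  | @head M N hstep _ ih =>
    obtain ⟨X, -, hX, rfl⟩ := hstep
    obtain ⟨m, S, h0, hm, hgt, hstep⟩ := ih (hA.invOn X)
    refine ⟨m + 1, fun k => Nat.casesOn k M S, rfl, hm, ?_, ?_⟩
    · rintro (_ | k) hk
      · exact hA
      · exact hgt k (by omega)
    · rintro (_ | k) hk
      · exact ⟨X, fun i hi j hj k hk =>
          hA.clan_of_isClanIn hX i hi j hj k (Finset.mem_univ k) hk, h0⟩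
      · exact hstep k (by omega)

end ClanSteps

/-! ### The equivalence -/

theorem theorem2p4 (n : ℕ) (A B : Matrix (Fin n) (Fin n) ℝ)
    (hA : IsGenTournament A) (hB : IsGenTournament B) :
    List.TFAE [
      ∀ X : Finset (Fin n), X.Nonempty → X.card ≤ 4 →
        principalMinor A X = principalMinor B X,
      ∀ X : Finset (Fin n), X.Nonempty → principalMinor A X = principalMinor B X,
      ∃ (m : ℕ) (S : ℕ → Matrix (Fin n) (Fin n) ℝ),
        S 0 = A ∧ S m = B ∧ (∀ k ≤ m, IsGenTournament (S k)) ∧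
        ∀ k < m, ∃ X : Finset (Fin n), IsClan (S k) X ∧ S (k + 1) = invOn (S k) X] := by
  tfae_have 2 → 1 := fun h X hX _ => h X hX
  tfae_have 1 → 3 := by
    intro h
    obtain ⟨N, hN, hNB⟩ := exists_steps_of_minors (V := Finset.univ) hA hB fun X _ => h X
    have hNB' : N = B := by
      ext i j
      exact (isGenTournament_of_steps hN hA).eq_of_skewPart hB
        (hNB i (Finset.mem_univ i) j (Finset.mem_univ j))
    exact exists_seq_of_steps (hNB' ▸ hN) hA
  tfae_have 3 → 2 := by
    rintro ⟨m, S, h0, hm, -, hstep⟩ Y -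
    have key : ∀ k ≤ m, principalMinor (S k) Y = principalMinor A Y := by
      intro k
      induction k with
      | zero => intro _; rw [h0]
      | succ k ih =>
        intro hk
        obtain ⟨X, hX, e⟩ := hstep k (by omega)
        rw [e, principalMinor_invOn _ _ _ fun i hi j hj k _ hkX => hX i hi j hj k hkX]
        exact ih (by omega)
    rw [← hm, key m le_rfl]
  tfae_finish
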